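/- Let $H$ be a separable real Hilbert space, let $X$ be an $H$-valued random variable, and assume: (A1) for every $h\in H$ there is $h'\in H$ with $\langle h,h'\rangle=0$ and $\operatorname{Var}(\langle X,h'\rangle)>0$ (the variance may be $+\infty$); (A2) there is a constant $C>0$ such that $\mathbb E\big[\|X-h\|^{-1}\big]\le C$ and $\mathbb E\big[\|X-h\|^{-2}\big]\le C$ for every $h\in H$. Let $G(h)=\mathbb E\big[\|X-h\|-\|X\|\big]$ for $h\in H$, let $m$ be the geometric median of $X$, that is, the minimizer of $G$ over $H$, and let $\Gamma_m$ be the Hessian of $G$ at $m$, viewed as a bounded operator on $H$. Let $X_1,X_2,\dots$ be independent random variables with the law of $X$, let $\gamma_n=c_\gamma n^{-\alpha}$ with $c_\gamma>0$ and $\alpha\in(1/2,1)$, let $Z_1$ be an almost surely bounded $H$-valued random variable independent of $(X_n)_{n\ge 2}$ (for instance deterministic, or a bounded function of $X_1$), and for $n\ge 1$ put $$Z_{n+1}=Z_n+\gamma_n\frac{X_{n+1}-Z_n}{\|X_{n+1}-Z_n\|},\qquad \overline Z_n=\frac1n\sum_{k=1}^n Z_k .$$ Then: 1. There is a constant $c>0$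 such that $$\mathbb E\big[\|\overline Z_n-m\|^2\big]\ \ge\ \frac cn$$ for all $n\ge 2$, and also for $n=1$ unless $Z_1=m$ almost surely. 2. More generally, for every integer $p\ge 1$ there is a constant $c_p>0$ such that $\mathbb E\big[\|\overline Z_n-m\|^{2p}\big]\ge c_p/n^{p}$ for all $n\ge 2$, and also for $n=1$ unless $Z_1=m$ almost surely. 3. $\mathbb E\big[\|\Gamma_m(\overline Z_n-m)\|^2\big]=\dfrac1n+o\Big(\dfrac1n\Big)$ as $n\to\infty$. -/

import Mathlib

open MeasureTheory ProbabilityTheory Filter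

namespace GeometricMedian

noncomputable section

variable {Ω H : Type*} [MeasurableSpace Ω] [NormedAddCommGroup H] [InnerProductSpace ℝ H]

/-- The law of `X` is not concentrated on a straight line: every `h` has an orthogonal direction `h'`
with `Var ⟨X, h'⟩ > 0`. The variance is the `[0, ∞]`-valued one, since `X` need not have moments. -/
def NotOnLine (μ : Measure Ω) (X : Ω → H) : Prop :=
  ∀ h : H, ∃ h' : H, inner ℝ h h' = 0 ∧ 0 < evariance (fun ω => inner ℝ (X ω) h') μ

/-- The law of `X` is not concentrated around single points: `E[1 / ‖X - h‖]` and `E[1 / ‖X - h‖²]`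
are bounded uniformly in `h`. The expectations are `[0, ∞]`-valued, with `1 / 0 = ∞`. -/
def NotAroundPoints (μ : Measure Ω) (X : Ω → H) : Prop :=
  ∃ C : ℝ, 0 < C ∧ ∀ h : H,
    ∫⁻ ω, (‖X ω - h‖ₑ)⁻¹ ∂μ ≤ ENNReal.ofReal C ∧
    ∫⁻ ω, (‖X ω - h‖ₑ ^ 2)⁻¹ ∂μ ≤ ENNReal.ofReal C

/-- The function `G(h) = E[‖X - h‖ - ‖X‖]`. -/
def objective (μ : Measure Ω) (X : Ω → H) (h : H) : ℝ :=
  ∫ ω, (‖X ω - h‖ - ‖X ω‖) ∂μ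

/-- `m` is a geometric median of `X`: it minimizes `G` over `H`. -/
def IsMedian (μ : Measure Ω) (X : Ω → H) (m : H) : Prop :=
  ∀ h : H, objective μ X m ≤ objective μ X h

/-- The Hessian `Γ_h` of `G` at `h`, as the operator on `H` that is the derivative of the gradient. -/
def hessian [CompleteSpace H] (μ : Measure Ω) (X : Ω → H) (h : H) : H →L[ℝ] H :=
  fderiv ℝ (gradient (objective μ X)) h

/-- The step sequence `γ_n = c n^{-α}`. -/
def step (c α : ℝ) (n : ℕ) : ℝ := c * (n : ℝ) ^ (-α)

/-- The stochastic gradient algorithm started at `Z₁`: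
`Z_{n+1} = Z_n + γ_n (X_{n+1} - Z_n) / ‖X_{n+1} - Z_n‖` for `n ≥ 1`.
Indices start at `1`; the value at `0` is a convention and is never used. -/
def robbinsMonro (γ : ℕ → ℝ) (X : ℕ → Ω → H) (Z₁ : Ω → H) : ℕ → Ω → H
  | 0 => 0
  | 1 => Z₁
  | n + 2 => fun ω =>
      robbinsMonro γ X Z₁ (n + 1) ω +
        γ (n + 1) • (‖X (n + 2) ω - robbinsMonro γ X Z₁ (n + 1) ω‖⁻¹ •
          (X (n + 2) ω - robbinsMonro γ X Z₁ (n + 1) ω))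

/-- The averaged algorithm `Z̄_n = (1/n) ∑_{k=1}^n Z_k`, `n ≥ 1`. -/
def averaged (γ : ℕ → ℝ) (X : ℕ → Ω → H) (Z₁ : Ω → H) (n : ℕ) (ω : Ω) : H :=
  (n : ℝ)⁻¹ • ∑ k ∈ Finset.Icc 1 n, robbinsMonro γ X Z₁ k ω

end

end GeometricMedian

open GeometricMedian

set_option linter.unusedSectionVars false

/-! Write `T_k = Z_k - m`, `U_k` for the unit direction of the step from `Z_k` to `Z_{k+1}`, `Φ` for
the gradient of `G`, and `Γ` for its Hessian at `m`. Given the past, `U_k` has mean `-Φ(Z_k)`, so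
`ξ_k = U_k + Φ(Z_k)` is a martingale difference. As `U_k` is almost surely a unit vector, `E‖ξ_k‖² =
1 - E‖Φ(Z_k)‖²`. Substituting `U_k = (T_{k+1} - T_k) / γ_k` in `Γ T_k = ξ_k - U_k - (Φ(Z_k) - Γ
T_k)` and summing by parts gives `Γ ∑ T_k = M_n - R_n` (`sum_clm_dev_eq`), where `E‖M_n‖² = n - ∑
E‖Φ(Z_k)‖² ~ n` (`integral_norm_noise_sq`).

The third claim follows once `R_n` is `o(√n)` in quadratic mean. It implies the first claim for
large `n`, because `‖Γ v‖ ≤ ‖Γ‖ ‖v‖`. Each remaining `n ≥ 2` only needs a positive second moment,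
which holds because the conditional mean of a unit direction has norm `< 1`, so the past cannot
cancel the last step (`integral_norm_sum_sq_pos`). The second claim is Jensen's inequality.

The remainder `R_n` contains linearization errors of size `‖T_k‖²` and summation-by-parts terms.
Both are controlled by `E‖T_k‖⁴ = O(k^{-κ})` with `κ > 1` and `κ > 4α - 2`
(`exists_integral_norm_pow_four_le`). This rate rests on a lower bound of the Hessian, valid in
infinite dimension (`exists_le_inner_meanDeriv_self`). The drift is quadratic only near `m` and
linear far away, so it is truncated at radius `k^ε`; the region beyond is paid for by the
boundedness of all moments (`exists_moment_le`). -/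

namespace GeometricMedian

/-! ### Taylor estimates for the norm and for the direction of a vector. -/

section Geometry

variable {H : Type*} [NormedAddCommGroup H] [InnerProductSpace ℝ H]

/-- The direction `x / ‖x‖` of a vector, with value `0` at `0`. -/
noncomputable def unitDir (x : H) : H := ‖x‖⁻¹ • x

/-- The derivative of `unitDir` at `x`. -/
noncomputable def unitDirDeriv (x : H) : H →L[ℝ] H :=
  ‖x‖⁻¹ • (ContinuousLinearMap.id ℝ H - (innerSL ℝ (unitDir x)).smulRight (unitDir x))

lemma norm_unitDir {x : H} (hx : x ≠ 0) : ‖unitDir x‖ = 1 := by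
  rw [unitDir, norm_smul, norm_inv, norm_norm, inv_mul_cancel₀ (norm_ne_zero_iff.2 hx)]

lemma norm_unitDir_le (x : H) : ‖unitDir x‖ ≤ 1 := by
  rcases eq_or_ne x 0 with rfl | hx
  · simp [unitDir]
  · exact (norm_unitDir hx).le

lemma norm_smul_unitDir (x : H) : ‖x‖ • unitDir x = x := by
  rcases eq_or_ne x 0 with rfl | hx
  · simp
  · rw [unitDir, smul_smul, mul_inv_cancel₀ (norm_ne_zero_iff.2 hx), one_smul]

lemma inner_unitDir_self (x : H) : inner ℝ (unitDir x) x = ‖x‖ := by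
  rcases eq_or_ne x 0 with rfl | hx
  · simp
  · rw [unitDir, real_inner_smul_left, real_inner_self_eq_norm_sq]
    have := norm_ne_zero_iff.2 hx
    field_simp

lemma inner_unitDir_le (x y : H) : inner ℝ (unitDir x) y ≤ ‖y‖ :=
  (real_inner_le_norm _ _).trans (mul_le_of_le_one_left (norm_nonneg _) (norm_unitDir_le x))

/-- An exact formula instead of a mean value argument: only `x ≠ 0` is needed, so the bounds derived
from it also hold when `y = 0` or when the segment from `x` to `y` meets the origin. After
integration they only involve inverse moments at one point. -/
lemma unitDir_sub_unitDir {x : H} (hx : x ≠ 0) (y : H) :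
    unitDir y - unitDir x = ‖x‖⁻¹ • ((y - x) + (‖x‖ - ‖y‖) • unitDir y) := by
  have h : ‖x‖ ≠ 0 := norm_ne_zero_iff.2 hx
  rw [sub_smul, norm_smul_unitDir y, show (y - x) + (‖x‖ • unitDir y - y) = ‖x‖ • unitDir y - x by
    abel, smul_sub, smul_smul, inv_mul_cancel₀ h, one_smul, unitDir, unitDir]

lemma norm_unitDir_sub_le {x : H} (hx : x ≠ 0) (y : H) :
    ‖unitDir y - unitDir x‖ ≤ 2 * ‖y - x‖ * ‖x‖⁻¹ := by
  rw [unitDir_sub_unitDir hx, norm_smul, norm_inv, norm_norm, mul_comm]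
  gcongr
  calc ‖(y - x) + (‖x‖ - ‖y‖) • unitDir y‖ ≤ ‖y - x‖ + |‖x‖ - ‖y‖| * ‖unitDir y‖ := by
        refine (norm_add_le _ _).trans_eq ?_
        rw [norm_smul, Real.norm_eq_abs]
    _ ≤ ‖y - x‖ + ‖y - x‖ * 1 := by
        gcongr
        · rw [abs_sub_comm]; exact abs_norm_sub_norm_le y x
        · exact norm_unitDir_le y
    _ = 2 * ‖y - x‖ := by ring

/-- By convexity of the norm, the error of the tangent at `x` is nonnegative and at most the
increment of the directions paired with `y - x`. -/
lemma abs_norm_sub_sub_inner_le {x : H} (hx : x ≠ 0) (y : H) :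
    |‖y‖ - ‖x‖ - inner ℝ (unitDir x) (y - x)| ≤ 2 * ‖y - x‖ ^ 2 * ‖x‖⁻¹ := by
  have h1 : ‖y‖ - ‖x‖ - inner ℝ (unitDir x) (y - x) = ‖y‖ - inner ℝ (unitDir x) y := by
    rw [inner_sub_right, inner_unitDir_self]; ring
  have h0 : 0 ≤ ‖y‖ - inner ℝ (unitDir x) y := sub_nonneg.2 (inner_unitDir_le x y)
  rw [h1, abs_of_nonneg h0]
  have h2 : ‖y‖ - inner ℝ (unitDir x) y ≤ inner ℝ (unitDir y - unitDir x) (y - x) := by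
    have := inner_unitDir_le y x
    rw [inner_sub_left, inner_sub_right, inner_sub_right, inner_unitDir_self, inner_unitDir_self]
    linarith
  refine (h2.trans (real_inner_le_norm _ _)).trans ?_
  have := mul_le_mul_of_nonneg_right (norm_unitDir_sub_le hx y) (norm_nonneg (y - x))
  linarith

lemma inner_unitDir_sub_nonneg (x y : H) : 0 ≤ inner ℝ (unitDir x - unitDir y) (x - y) := by
  have h1 := inner_unitDir_le y x
  have h2 := inner_unitDir_le x y
  rw [inner_sub_left, inner_sub_right, inner_sub_right, inner_unitDir_self, inner_unitDir_self]
  linarith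

lemma unitDirDeriv_apply (x v : H) :
    unitDirDeriv x v = ‖x‖⁻¹ • (v - inner ℝ (unitDir x) v • unitDir x) := by
  simp [unitDirDeriv]

lemma norm_unitDirDeriv_le (x : H) : ‖unitDirDeriv x‖ ≤ 2 * ‖x‖⁻¹ := by
  refine ContinuousLinearMap.opNorm_le_bound _ (by positivity) fun v => ?_
  rw [unitDirDeriv_apply, norm_smul, norm_inv, norm_norm]
  have h1 : ‖v - inner ℝ (unitDir x) v • unitDir x‖ ≤ 2 * ‖v‖ := by
    refine (norm_sub_le _ _).trans ?_
    rw [norm_smul]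
    have h2 : ‖inner ℝ (unitDir x) v‖ ≤ ‖v‖ :=
      (norm_inner_le_norm _ _).trans (mul_le_of_le_one_left (norm_nonneg _) (norm_unitDir_le x))
    have := mul_le_mul h2 (norm_unitDir_le x) (norm_nonneg _) (norm_nonneg v)
    linarith
  have := mul_le_mul_of_nonneg_left h1 (inv_nonneg.2 (norm_nonneg x))
  linarith

lemma norm_unitDir_sub_sub_deriv_le {x : H} (hx : x ≠ 0) (y : H) :
    ‖unitDir y - unitDir x - unitDirDeriv x (y - x)‖ ≤ 4 * ‖y - x‖ ^ 2 * (‖x‖ ^ 2)⁻¹ := by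
  -- Splitting `unitDir y` as `(unitDir y - unitDir x) + unitDir x` leaves a product of two
  -- first-order differences and the second-order remainder of the norm.
  have key : unitDir y - unitDir x - unitDirDeriv x (y - x) =
      ‖x‖⁻¹ • ((‖x‖ - ‖y‖) • (unitDir y - unitDir x)
        + (-(‖y‖ - ‖x‖ - inner ℝ (unitDir x) (y - x))) • unitDir x) := by
    rw [unitDir_sub_unitDir hx, unitDirDeriv_apply, ← smul_sub, ← unitDir_sub_unitDir hx]
    congr 1
    module
  rw [key, norm_smul, norm_inv, norm_norm]
  have h1 : ‖(‖x‖ - ‖y‖) • (unitDir y - unitDir x)‖ ≤ ‖y - x‖ * (2 * ‖y - x‖ * ‖x‖⁻¹) := by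
    rw [norm_smul]
    refine mul_le_mul ?_ (norm_unitDir_sub_le hx y) (norm_nonneg _) (norm_nonneg _)
    rw [Real.norm_eq_abs, abs_sub_comm]; exact abs_norm_sub_norm_le y x
  have h2 : ‖(-(‖y‖ - ‖x‖ - inner ℝ (unitDir x) (y - x))) • unitDir x‖
      ≤ 2 * ‖y - x‖ ^ 2 * ‖x‖⁻¹ := by
    rw [norm_smul, norm_unitDir hx, mul_one, norm_neg]
    exact abs_norm_sub_sub_inner_le hx y
  calc _ ≤ ‖x‖⁻¹ * (‖y - x‖ * (2 * ‖y - x‖ * ‖x‖⁻¹) + 2 * ‖y - x‖ ^ 2 * ‖x‖⁻¹) := by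
        gcongr
        exact (norm_add_le _ _).trans (add_le_add h1 h2)
    _ = _ := by rw [← inv_pow]; ring

/-- For a unit vector `t` and `x ≠ 0` the bracket is the squared sine of the angle between `x` and
`t`, so the quadratic form of the Hessian is a weighted mean of squared sines. -/
lemma inner_unitDirDeriv_self (x t : H) :
    inner ℝ (unitDirDeriv x t) t = ‖x‖⁻¹ * (‖t‖ ^ 2 - inner ℝ (unitDir x) t ^ 2) := by
  rw [unitDirDeriv_apply, real_inner_smul_left, inner_sub_left, real_inner_smul_left,
    real_inner_self_eq_norm_sq]
  ring

lemma one_sub_inner_sq_nonneg {u v : H} (hu : ‖u‖ ≤ 1) (hv : ‖v‖ ≤ 1) :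
    0 ≤ 1 - inner ℝ u v ^ 2 := by
  have h := (abs_real_inner_le_norm u v).trans
    (mul_le_one₀ hu (norm_nonneg v) hv)
  rw [abs_le] at h
  nlinarith [h.1, h.2]

/-- The squared sine of the angle between two lines satisfies a triangle inequality up to a
factor `2`. -/
lemma one_sub_inner_sq_le {u v t : H} (hu : ‖u‖ = 1) (hv : ‖v‖ = 1) (ht : ‖t‖ = 1) :
    1 - inner ℝ u v ^ 2 ≤ 2 * (1 - inner ℝ u t ^ 2) + 2 * (1 - inner ℝ v t ^ 2) := by
  set a := inner ℝ u t with ha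
  set b := inner ℝ v t with hb
  -- The squared sine is the squared distance from `u` to the line of `v`, so any multiple of `v`
  -- bounds it. The multiple `(a * b) • v` comes from projecting `u` on `t`, then `t` on `v`.
  have h1 : 1 - inner ℝ u v ^ 2 ≤ ‖u - (a * b) • v‖ ^ 2 := by
    rw [norm_sub_sq_real, norm_smul, real_inner_smul_right, hu, hv, mul_one, Real.norm_eq_abs,
      sq_abs]
    nlinarith [sq_nonneg (inner ℝ u v - a * b)]
  have h2 : ‖u - a • t‖ ^ 2 = 1 - a ^ 2 := by
    rw [norm_sub_sq_real, norm_smul, real_inner_smul_right, hu, ht, mul_one, Real.norm_eq_abs,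
      sq_abs, ← ha]
    ring
  have h3 : ‖t - b • v‖ ^ 2 = 1 - b ^ 2 := by
    rw [norm_sub_sq_real, norm_smul, real_inner_smul_right, hv, ht, mul_one, Real.norm_eq_abs,
      sq_abs, real_inner_comm, ← hb]
    ring
  have h4 : u - (a * b) • v = (u - a • t) + a • (t - b • v) := by module
  have h5 : ‖a • (t - b • v)‖ ^ 2 ≤ 1 - b ^ 2 := by
    rw [norm_smul, mul_pow, h3, Real.norm_eq_abs, sq_abs]
    have : 0 ≤ 1 - b ^ 2 := by rw [← h3]; positivity
    have : 0 ≤ 1 - a ^ 2 := by rw [← h2]; positivity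
    nlinarith
  have h6 : ‖(u - a • t) + a • (t - b • v)‖ ≤ ‖u - a • t‖ + ‖a • (t - b • v)‖ := norm_add_le _ _
  rw [h4] at h1
  have h7 := pow_le_pow_left₀ (norm_nonneg _) h6 2
  nlinarith [sq_nonneg (‖u - a • t‖ - ‖a • (t - b • v)‖)]

end Geometry

/-! ### Gradient and Hessian of the objective. -/

section Objective

variable {Ω H : Type*} [MeasurableSpace Ω] [NormedAddCommGroup H] [InnerProductSpace ℝ H]

/-- The gradient of the objective, `Φ(h) = -E[(X - h) / ‖X - h‖]`. -/
noncomputable def meanDir (μ : Measure Ω) (X : Ω → H) (h : H) : H := -∫ ω, unitDir (X ω - h) ∂μ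

/-- The expectation of the derivative of `unitDir` at `X - h`. -/
noncomputable def meanDeriv (μ : Measure Ω) (X : Ω → H) (h : H) : H →L[ℝ] H :=
  ∫ ω, unitDirDeriv (X ω - h) ∂μ

/-- Real-valued form of `NotAroundPoints`, with its constant. -/
structure InvMomentBound (μ : Measure Ω) (X : Ω → H) (C : ℝ) : Prop where
  pos : 0 < C
  ne : ∀ h, ∀ᵐ ω ∂μ, X ω ≠ h
  integrable_inv : ∀ h, Integrable (fun ω => ‖X ω - h‖⁻¹) μ
  integral_inv_le : ∀ h, ∫ ω, ‖X ω - h‖⁻¹ ∂μ ≤ C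
  integrable_inv_sq : ∀ h, Integrable (fun ω => (‖X ω - h‖ ^ 2)⁻¹) μ
  integral_inv_sq_le : ∀ h, ∫ ω, (‖X ω - h‖ ^ 2)⁻¹ ∂μ ≤ C

lemma integrable_and_integral_le_of_lintegral_ofReal_le {μ : Measure Ω} {f : Ω → ℝ} {C : ℝ}
    (hf : AEStronglyMeasurable f μ) (hC : 0 ≤ C) (hf0 : ∀ ω, 0 ≤ f ω)
    (h : ∫⁻ ω, ENNReal.ofReal (f ω) ∂μ ≤ ENNReal.ofReal C) :
    Integrable f μ ∧ ∫ ω, f ω ∂μ ≤ C := by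
  have hi : Integrable f μ := by
    refine (lintegral_ofReal_ne_top_iff_integrable hf (Eventually.of_forall hf0)).1 ?_
    exact (h.trans_lt ENNReal.ofReal_lt_top).ne
  refine ⟨hi, ?_⟩
  rw [integral_eq_lintegral_of_nonneg_ae (Eventually.of_forall hf0) hf]
  exact ENNReal.toReal_le_of_le_ofReal hC h

variable [MeasurableSpace H] [BorelSpace H] [TopologicalSpace.SeparableSpace H]

/-- With `1 / 0 = ∞`, finiteness of the first integral excludes atoms of the law; off the null set
`X = h` the extended and real inverses agree. -/
lemma NotAroundPoints.exists_invMomentBound {μ : Measure Ω} {X : Ω → H} (hX : Measurable X)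
    (hA : NotAroundPoints μ X) : ∃ C, InvMomentBound μ X C := by
  obtain ⟨C, hC, h⟩ := hA
  have hne : ∀ h, ∀ᵐ ω ∂μ, X ω ≠ h := by
    intro x
    have hm : Measurable fun ω => (‖X ω - x‖ₑ)⁻¹ := by fun_prop
    have := ae_lt_top hm ((h x).1.trans_lt ENNReal.ofReal_lt_top).ne
    filter_upwards [this] with ω hω
    rintro rfl
    simp at hω
  have h1 : ∀ x, Integrable (fun ω => ‖X ω - x‖⁻¹) μ ∧ ∫ ω, ‖X ω - x‖⁻¹ ∂μ ≤ C := by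
    intro x
    refine integrable_and_integral_le_of_lintegral_ofReal_le
      (by fun_prop) hC.le (fun ω => by positivity) ?_
    refine le_of_eq_of_le (lintegral_congr_ae ?_) (h x).1
    filter_upwards [hne x] with ω hω
    have : 0 < ‖X ω - x‖ := norm_pos_iff.2 (sub_ne_zero.2 hω)
    rw [ENNReal.ofReal_inv_of_pos this, ofReal_norm]
  have h2 : ∀ x, Integrable (fun ω => (‖X ω - x‖ ^ 2)⁻¹) μ ∧ ∫ ω, (‖X ω - x‖ ^ 2)⁻¹ ∂μ ≤ C := by
    intro x
    refine integrable_and_integral_le_of_lintegral_ofReal_le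
      (by fun_prop) hC.le (fun ω => by positivity) ?_
    refine le_of_eq_of_le (lintegral_congr_ae ?_) (h x).2
    filter_upwards [hne x] with ω hω
    have : 0 < ‖X ω - x‖ := norm_pos_iff.2 (sub_ne_zero.2 hω)
    rw [ENNReal.ofReal_inv_of_pos (by positivity), ENNReal.ofReal_pow this.le,
      ofReal_norm]
  exact ⟨C, hC, hne, fun x => (h1 x).1, fun x => (h1 x).2, fun x => (h2 x).1, fun x => (h2 x).2⟩

lemma measurable_unitDir : Measurable (unitDir : H → H) := by
  unfold unitDir; fun_prop

lemma stronglyMeasurable_unitDirDeriv :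
    StronglyMeasurable (unitDirDeriv : H → H →L[ℝ] H) := by
  have h1 : StronglyMeasurable (fun x : H => ‖x‖⁻¹) :=
    Measurable.stronglyMeasurable (by fun_prop)
  have h2 : StronglyMeasurable (unitDir : H → H) := measurable_unitDir.stronglyMeasurable
  have h3 : Continuous fun u : H => (innerSL ℝ u).smulRight u := by fun_prop
  exact h1.smul (stronglyMeasurable_const.sub (h3.comp_stronglyMeasurable h2))

variable {μ : Measure Ω} [IsProbabilityMeasure μ] {X : Ω → H} {C : ℝ}

lemma integrable_unitDir (hX : Measurable X) (h : H) :
    Integrable (fun ω => unitDir (X ω - h)) μ := by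
  refine Integrable.of_bound (C := 1) ?_ (Eventually.of_forall fun ω => norm_unitDir_le _)
  exact (measurable_unitDir.comp (hX.sub_const h)).aestronglyMeasurable

lemma integrable_unitDirDeriv (hX : Measurable X) (hA : InvMomentBound μ X C) (h : H) :
    Integrable (fun ω => unitDirDeriv (X ω - h)) μ := by
  refine ((hA.integrable_inv h).const_mul 2).mono' ?_
    (Eventually.of_forall fun ω => norm_unitDirDeriv_le _)
  exact (stronglyMeasurable_unitDirDeriv.comp_measurable (hX.sub_const h)).aestronglyMeasurable

lemma integrable_norm_sub_sub_norm (hX : Measurable X) (h : H) :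
    Integrable (fun ω => ‖X ω - h‖ - ‖X ω‖) μ := by
  refine Integrable.of_bound (C := ‖h‖) (by fun_prop) (Eventually.of_forall fun ω => ?_)
  rw [Real.norm_eq_abs]
  refine (abs_norm_sub_norm_le _ _).trans (le_of_eq ?_)
  simp

lemma norm_meanDir_le (h : H) : ‖meanDir μ X h‖ ≤ 1 := by
  rw [meanDir, norm_neg]
  refine (norm_integral_le_of_norm_le_const
    (Eventually.of_forall fun ω => norm_unitDir_le (X ω - h))).trans ?_
  simp

lemma norm_meanDir_sub_le (hX : Measurable X) (hA : InvMomentBound μ X C) (h h' : H) :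
    ‖meanDir μ X h' - meanDir μ X h‖ ≤ 2 * C * ‖h' - h‖ := by
  rw [meanDir, meanDir, neg_sub_neg, ← integral_sub (integrable_unitDir hX _)
    (integrable_unitDir hX _)]
  calc _ ≤ ∫ ω, 2 * ‖h' - h‖ * ‖X ω - h‖⁻¹ ∂μ := by
        refine norm_integral_le_of_norm_le ((hA.integrable_inv h).const_mul _) ?_
        filter_upwards [hA.ne h] with ω hω
        rw [norm_sub_rev]
        refine (norm_unitDir_sub_le (sub_ne_zero.2 hω) (X ω - h')).trans_eq ?_
        rw [sub_sub_sub_cancel_left, norm_sub_rev h]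
    _ ≤ 2 * ‖h' - h‖ * C := by
        rw [integral_const_mul]
        exact mul_le_mul_of_nonneg_left (hA.integral_inv_le h) (by positivity)
    _ = _ := by ring

lemma continuous_meanDir (hX : Measurable X) (hA : InvMomentBound μ X C) :
    Continuous (meanDir μ X) := by
  refine LipschitzWith.continuous (K := ⟨2 * C, by have := hA.pos; positivity⟩) ?_
  refine LipschitzWith.of_dist_le_mul fun x y => ?_
  rw [dist_eq_norm, dist_eq_norm]
  exact norm_meanDir_sub_le hX hA y x

variable [CompleteSpace H]

/-- The first-order expansion of the norm is integrated; the remainder is quadratic in `h' - h`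
because `E[1 / ‖X - h‖]` is bounded. -/
lemma hasGradientAt_objective (hX : Measurable X) (hA : InvMomentBound μ X C) (h : H) :
    HasGradientAt (objective μ X) (meanDir μ X h) h := by
  rw [hasGradientAt_iff_isLittleO]
  have hO : (fun h' => objective μ X h' - objective μ X h - inner ℝ (meanDir μ X h) (h' - h))
      =O[nhds h] fun h' => ‖h' - h‖ ^ 2 := by
    refine Asymptotics.IsBigO.of_bound (2 * C) (Eventually.of_forall fun h' => ?_)
    have e : objective μ X h' - objective μ X h - inner ℝ (meanDir μ X h) (h' - h) =
        ∫ ω, (‖X ω - h'‖ - ‖X ω - h‖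
          - inner ℝ (unitDir (X ω - h)) ((X ω - h') - (X ω - h))) ∂μ := by
      have hi : Integrable (fun ω => inner ℝ (unitDir (X ω - h)) (h - h')) μ :=
        (integrable_unitDir hX h).inner_const _
      have e1 : ∀ ω, ‖X ω - h'‖ - ‖X ω - h‖
          - inner ℝ (unitDir (X ω - h)) ((X ω - h') - (X ω - h)) =
          ((‖X ω - h'‖ - ‖X ω‖) - (‖X ω - h‖ - ‖X ω‖)) - inner ℝ (unitDir (X ω - h)) (h - h') := by
        intro ω; rw [sub_sub_sub_cancel_left]; ring
      simp_rw [e1]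
      have hd : Integrable (fun ω => (‖X ω - h'‖ - ‖X ω‖) - (‖X ω - h‖ - ‖X ω‖)) μ :=
        (integrable_norm_sub_sub_norm hX h').sub (integrable_norm_sub_sub_norm hX h)
      rw [integral_sub hd hi, integral_sub (integrable_norm_sub_sub_norm hX h')
        (integrable_norm_sub_sub_norm hX h)]
      have e2 : ∫ ω, inner ℝ (unitDir (X ω - h)) (h - h') ∂μ =
          inner ℝ (∫ ω, unitDir (X ω - h) ∂μ) (h - h') := by
        simp_rw [real_inner_comm (h - h')]
        exact integral_inner (integrable_unitDir hX h) _
      rw [e2, meanDir, inner_neg_left, ← inner_neg_right, neg_sub]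
      rfl
    rw [e]
    calc _ ≤ ∫ ω, 2 * ‖h' - h‖ ^ 2 * ‖X ω - h‖⁻¹ ∂μ := by
          refine norm_integral_le_of_norm_le ((hA.integrable_inv h).const_mul _) ?_
          filter_upwards [hA.ne h] with ω hω
          refine (abs_norm_sub_sub_inner_le (sub_ne_zero.2 hω) (X ω - h')).trans_eq ?_
          rw [sub_sub_sub_cancel_left, norm_sub_rev h]
      _ ≤ 2 * ‖h' - h‖ ^ 2 * C := by
          rw [integral_const_mul]
          exact mul_le_mul_of_nonneg_left (hA.integral_inv_le h) (by positivity)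
      _ = _ := by rw [norm_pow, norm_norm]; ring
  exact hO.trans_isLittleO (Asymptotics.isLittleO_norm_pow_id one_lt_two |>.comp_tendsto
    (tendsto_sub_nhds_zero_iff.2 tendsto_id))

lemma meanDir_eq_zero (hX : Measurable X) (hA : InvMomentBound μ X C) {m : H}
    (hm : IsMedian μ X m) : meanDir μ X m = 0 := by
  have h1 := (hasGradientAt_objective hX hA m).hasFDerivAt
  have h2 : IsLocalMin (objective μ X) m := Eventually.of_forall hm
  have h3 := h2.hasFDerivAt_eq_zero h1
  simpa using h3

lemma norm_meanDir_sub_sub_le (hX : Measurable X) (hA : InvMomentBound μ X C) (h h' : H) :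
    ‖meanDir μ X h' - meanDir μ X h - meanDeriv μ X h (h' - h)‖ ≤ 4 * C * ‖h' - h‖ ^ 2 := by
  have hi : Integrable (fun ω => unitDirDeriv (X ω - h) (h' - h)) μ :=
    (integrable_unitDirDeriv hX hA h).apply_continuousLinearMap _
  have hd : Integrable (fun ω => unitDir (X ω - h) - unitDir (X ω - h')) μ :=
    (integrable_unitDir hX _).sub (integrable_unitDir hX _)
  rw [meanDir, meanDir, meanDeriv, ContinuousLinearMap.integral_apply
    (integrable_unitDirDeriv hX hA h), neg_sub_neg, ← integral_sub (integrable_unitDir hX _)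
    (integrable_unitDir hX _), ← integral_sub hd hi]
  calc _ ≤ ∫ ω, 4 * ‖h' - h‖ ^ 2 * (‖X ω - h‖ ^ 2)⁻¹ ∂μ := by
        refine norm_integral_le_of_norm_le ((hA.integrable_inv_sq h).const_mul _) ?_
        filter_upwards [hA.ne h] with ω hω
        have := norm_unitDir_sub_sub_deriv_le (sub_ne_zero.2 hω) (X ω - h')
        rw [sub_sub_sub_cancel_left, norm_sub_rev h] at this
        refine le_of_eq_of_le ?_ this
        rw [← norm_neg, ← neg_sub h' h, map_neg]
        congr 1
        abel
    _ ≤ 4 * ‖h' - h‖ ^ 2 * C := by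
        rw [integral_const_mul]
        exact mul_le_mul_of_nonneg_left (hA.integral_inv_sq_le h) (by positivity)
    _ = _ := by ring

/-- Same argument one order higher, where the inverse square moment enters. -/
lemma hessian_eq_meanDeriv (hX : Measurable X) (hA : InvMomentBound μ X C) (h : H) :
    hessian μ X h = meanDeriv μ X h := by
  have hg : gradient (objective μ X) = meanDir μ X :=
    funext fun h => (hasGradientAt_objective hX hA h).gradient
  rw [hessian, hg]
  refine HasFDerivAt.fderiv ?_
  rw [hasFDerivAt_iff_isLittleO]
  have hO : (fun h' => meanDir μ X h' - meanDir μ X h - meanDeriv μ X h (h' - h))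
      =O[nhds h] fun h' => ‖h' - h‖ ^ 2 := by
    refine Asymptotics.IsBigO.of_bound (4 * C) (Eventually.of_forall fun h' => ?_)
    rw [norm_pow, norm_norm]
    exact norm_meanDir_sub_sub_le hX hA h h'
  exact hO.trans_isLittleO (Asymptotics.isLittleO_norm_pow_id one_lt_two |>.comp_tendsto
    (tendsto_sub_nhds_zero_iff.2 tendsto_id))

end Objective

/-! ### Lower bounds for the Hessian and for the drift. -/

section Convexity

variable {Ω H : Type*} [MeasurableSpace Ω] [NormedAddCommGroup H] [InnerProductSpace ℝ H]

/-- On a line of direction `u`, the pairing of `X` with any vector orthogonal to `u` is constant,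
hence has zero variance. -/
lemma NotOnLine.not_ae_mem_line {μ : Measure Ω} [IsProbabilityMeasure μ] {X : Ω → H}
    (hA : NotOnLine μ X) (a u : H) : ¬ ∀ᵐ ω ∂μ, ∃ c : ℝ, X ω - a = c • u := by
  intro h
  obtain ⟨h', h0, hpos⟩ := hA u
  have hc : (fun ω => inner ℝ (X ω) h') =ᵐ[μ] fun _ => inner ℝ a h' := by
    filter_upwards [h] with ω ⟨c, hc⟩
    rw [← sub_eq_zero, ← inner_sub_left, hc, real_inner_smul_left, h0, mul_zero]
  rw [evariance_congr hc] at hpos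
  simp [evariance] at hpos

variable [MeasurableSpace H] [BorelSpace H] [TopologicalSpace.SeparableSpace H] [CompleteSpace H]
variable {μ : Measure Ω} [IsProbabilityMeasure μ] {X : Ω → H} {C : ℝ}

/-- A mean of unit vectors has norm one only if they almost surely coincide, which would put `X` on
a half-line from `h`. -/
lemma norm_meanDir_lt_one (hX : Measurable X) (hL : NotOnLine μ X) (hA : InvMomentBound μ X C)
    (h : H) : ‖meanDir μ X h‖ < 1 := by
  refine lt_of_le_of_ne (norm_meanDir_le h) fun h1 => ?_
  set e := -meanDir μ X h with he
  have he1 : ‖e‖ = 1 := by rw [he, norm_neg, h1]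
  have hi : Integrable (fun ω => inner ℝ e (unitDir (X ω - h))) μ :=
    (integrable_unitDir hX h).const_inner e
  have h2 : ∫ ω, (1 - inner ℝ e (unitDir (X ω - h))) ∂μ = 0 := by
    rw [integral_sub (integrable_const _) hi, integral_inner (integrable_unitDir hX h)]
    have : ∫ ω, unitDir (X ω - h) ∂μ = e := by rw [he, meanDir, neg_neg]
    rw [this, real_inner_self_eq_norm_sq, he1]
    simp
  have h3 : 0 ≤ fun ω => 1 - inner ℝ e (unitDir (X ω - h)) := fun ω => by
    have := real_inner_le_norm e (unitDir (X ω - h))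
    rw [he1, one_mul] at this
    have := norm_unitDir_le (X ω - h)
    simp only [Pi.zero_apply]
    linarith
  have h4 := (integral_eq_zero_iff_of_nonneg h3 ((integrable_const _).sub hi)).1 h2
  refine hL.not_ae_mem_line h e ?_
  filter_upwards [h4, hA.ne h] with ω hω hne
  refine ⟨‖X ω - h‖, ?_⟩
  have h5 : inner ℝ e (unitDir (X ω - h)) = 1 := by
    have : 1 - inner ℝ e (unitDir (X ω - h)) = 0 := hω
    linarith
  rw [(inner_eq_one_iff_of_norm_eq_one he1 (norm_unitDir (sub_ne_zero.2 hne))).1 h5,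
    norm_smul_unitDir]

lemma inner_meanDeriv_self (hX : Measurable X) (hA : InvMomentBound μ X C) (h t : H) :
    inner ℝ (meanDeriv μ X h t) t =
      ∫ ω, ‖X ω - h‖⁻¹ * (‖t‖ ^ 2 - inner ℝ (unitDir (X ω - h)) t ^ 2) ∂μ := by
  have hi := integrable_unitDirDeriv hX hA h
  rw [meanDeriv, ContinuousLinearMap.integral_apply hi, real_inner_comm t,
    ← integral_inner (𝕜 := ℝ) (hi.apply_continuousLinearMap t)]
  refine integral_congr_ae (Eventually.of_forall fun ω => ?_)
  exact (real_inner_comm (unitDirDeriv (X ω - h) t) t).trans (inner_unitDirDeriv_self _ _)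

lemma integrable_quadForm (hX : Measurable X) (hA : InvMomentBound μ X C) (h t : H) :
    Integrable (fun ω => ‖X ω - h‖⁻¹ * (‖t‖ ^ 2 - inner ℝ (unitDir (X ω - h)) t ^ 2)) μ := by
  have := ((integrable_unitDirDeriv hX hA h).apply_continuousLinearMap t).inner_const (𝕜 := ℝ) t
  refine this.congr (Eventually.of_forall fun ω => ?_)
  exact inner_unitDirDeriv_self _ _

/-- If the mean of the squared sines vanished, `X - h` would almost surely be parallel to `t`. -/
lemma inner_meanDeriv_self_pos (hX : Measurable X) (hL : NotOnLine μ X)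
    (hA : InvMomentBound μ X C) (h : H) {t : H} (ht : ‖t‖ = 1) :
    0 < inner ℝ (meanDeriv μ X h t) t := by
  rw [inner_meanDeriv_self hX hA]
  have h0 : 0 ≤ fun ω => ‖X ω - h‖⁻¹ * (‖t‖ ^ 2 - inner ℝ (unitDir (X ω - h)) t ^ 2) := fun ω => by
    rw [ht, one_pow]
    exact mul_nonneg (by positivity) (one_sub_inner_sq_nonneg (norm_unitDir_le _) ht.le)
  refine lt_of_le_of_ne (integral_nonneg h0) fun h1 => ?_
  have h2 := (integral_eq_zero_iff_of_nonneg h0 (integrable_quadForm hX hA h t)).1 h1.symm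
  refine hL.not_ae_mem_line h t ?_
  filter_upwards [h2, hA.ne h] with ω hω hne
  set u := unitDir (X ω - h) with hu
  have hne' := sub_ne_zero.2 hne
  have h3 : ‖t‖ ^ 2 - inner ℝ u t ^ 2 = 0 :=
    (mul_eq_zero.1 hω).resolve_left (inv_ne_zero (norm_ne_zero_iff.2 hne'))
  have h4 : ‖u - inner ℝ u t • t‖ ^ 2 = 0 := by
    rw [norm_sub_sq_real, norm_smul, real_inner_smul_right, hu, norm_unitDir hne', ht, mul_one,
      Real.norm_eq_abs, sq_abs, ← hu]
    rw [ht] at h3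
    linarith
  have h5 : u = inner ℝ u t • t := by
    rw [← sub_eq_zero, ← norm_eq_zero]; exact pow_eq_zero_iff two_ne_zero |>.1 h4
  refine ⟨‖X ω - h‖ * inner ℝ u t, ?_⟩
  rw [mul_smul, ← h5, hu, norm_smul_unitDir]

/-- The triangle inequality for squared sines, integrated. It compares the Hessian in two directions
and is the substitute for compactness below. -/
lemma inner_meanDeriv_self_le (hX : Measurable X) (hA : InvMomentBound μ X C) (h : H) {t v : H}
    (ht : ‖t‖ = 1) (hv : ‖v‖ = 1) :
    inner ℝ (meanDeriv μ X h v) v ≤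
      2 * inner ℝ (meanDeriv μ X h t) t + 2 * C * (1 - inner ℝ v t ^ 2) := by
  calc inner ℝ (meanDeriv μ X h v) v
      ≤ ∫ ω, (2 * (‖X ω - h‖⁻¹ * (‖t‖ ^ 2 - inner ℝ (unitDir (X ω - h)) t ^ 2))
          + 2 * (1 - inner ℝ v t ^ 2) * ‖X ω - h‖⁻¹) ∂μ := by
        rw [inner_meanDeriv_self hX hA]
        refine integral_mono_ae (integrable_quadForm hX hA h v)
          (((integrable_quadForm hX hA h t).const_mul 2).add
            ((hA.integrable_inv h).const_mul _)) ?_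
        filter_upwards [hA.ne h] with ω hω
        have := mul_le_mul_of_nonneg_left (one_sub_inner_sq_le
          (norm_unitDir (sub_ne_zero.2 hω)) hv ht) (inv_nonneg.2 (norm_nonneg (X ω - h)))
        rw [ht, hv, one_pow]
        linarith
    _ = 2 * inner ℝ (meanDeriv μ X h t) t
          + 2 * (1 - inner ℝ v t ^ 2) * ∫ ω, ‖X ω - h‖⁻¹ ∂μ := by
        rw [integral_add ((integrable_quadForm hX hA h t).const_mul 2)
          ((hA.integrable_inv h).const_mul _), integral_const_mul, integral_const_mul,
          ← inner_meanDeriv_self hX hA]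
    _ ≤ _ := by
        have := mul_le_mul_of_nonneg_left (hA.integral_inv_le h)
          (one_sub_inner_sq_nonneg hv.le ht.le)
        linarith

/-- The Hessian is bounded below. The bound is averaged over the directions of `X - h`
themselves, so no compactness of the unit sphere is needed. -/
lemma exists_le_inner_meanDeriv_self (hX : Measurable X) (hL : NotOnLine μ X)
    (hA : InvMomentBound μ X C) (h : H) :
    ∃ l : ℝ, 0 < l ∧ ∀ t, l * ‖t‖ ^ 2 ≤ inner ℝ (meanDeriv μ X h t) t := by
  set Q : H → ℝ := fun t => inner ℝ (meanDeriv μ X h t) t with hQ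
  set w : Ω → ℝ := fun ω => ‖X ω - h‖⁻¹ with hw
  set u : Ω → H := fun ω => unitDir (X ω - h) with hu
  have hCpos := hA.pos
  have hu1 : ∀ᵐ ω ∂μ, ‖u ω‖ = 1 := by
    filter_upwards [hA.ne h] with ω hω using norm_unitDir (sub_ne_zero.2 hω)
  have hwpos : ∀ᵐ ω ∂μ, 0 < w ω := by
    filter_upwards [hA.ne h] with ω hω using inv_pos.2 (norm_pos_iff.2 (sub_ne_zero.2 hω))
  have hum : Measurable u := measurable_unitDir.comp (hX.sub_const h)
  have hQc : Continuous Q := by fun_prop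
  have hint : Integrable (fun ω => w ω * Q (u ω)) μ := by
    refine (hA.integrable_inv h).mul_bdd (c := ‖meanDeriv μ X h‖)
      (hQc.measurable.comp hum).aestronglyMeasurable (Eventually.of_forall fun ω => ?_)
    have hun := norm_unitDir_le (X ω - h)
    refine (norm_inner_le_norm _ _).trans ?_
    calc _ ≤ ‖meanDeriv μ X h‖ * ‖u ω‖ * ‖u ω‖ := by
          gcongr; exact ContinuousLinearMap.le_opNorm _ _
      _ ≤ ‖meanDeriv μ X h‖ * 1 * 1 := by gcongr
      _ = _ := by ring
  -- The quadratic form averaged over the random direction `u`, with weight `w`: a positive number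
  -- independent of `t`.
  set I := ∫ ω, w ω * Q (u ω) ∂μ with hI
  have hpos : ∀ᵐ ω ∂μ, 0 < w ω * Q (u ω) := by
    filter_upwards [hu1, hwpos] with ω h1 h2
    exact mul_pos h2 (inner_meanDeriv_self_pos hX hL hA h h1)
  have hIpos : 0 < I := by
    have h0 : 0 ≤ᵐ[μ] fun ω => w ω * Q (u ω) := by
      filter_upwards [hpos] with ω hω using hω.le
    refine lt_of_le_of_ne (integral_nonneg_of_ae h0) fun h1 => ?_
    have h2 := (integral_eq_zero_iff_of_nonneg_ae h0 hint).1 h1.symm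
    obtain ⟨ω, h3, h4⟩ := (h2.and hpos).exists
    exact h4.ne' h3
  have hunit : ∀ t, ‖t‖ = 1 → I ≤ 4 * C * Q t := by
    intro t ht
    have hq : ∫ ω, w ω * (1 - inner ℝ (u ω) t ^ 2) ∂μ = Q t := by
      simp only [hQ, inner_meanDeriv_self hX hA, ht, one_pow, hw, hu]
    have hqi : Integrable (fun ω => w ω * (1 - inner ℝ (u ω) t ^ 2)) μ := by
      have := integrable_quadForm hX hA h t
      rwa [ht, one_pow] at this
    -- The comparison of directions is used with `v = u ω` and integrated against `w`. The weighted
    -- mean of the squared sines between `u` and `t` is `Q t` itself, so both terms are multiples of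
    -- `Q t`.
    calc I ≤ ∫ ω, (2 * Q t * w ω + 2 * C * (w ω * (1 - inner ℝ (u ω) t ^ 2))) ∂μ := by
          refine integral_mono_ae hint (((hA.integrable_inv h).const_mul _).add
            (hqi.const_mul _)) ?_
          filter_upwards [hu1, hwpos] with ω h1 h2
          have := mul_le_mul_of_nonneg_left (inner_meanDeriv_self_le hX hA h ht h1) h2.le
          simp only [hQ]
          linarith
      _ = 2 * Q t * ∫ ω, w ω ∂μ + 2 * C * Q t := by
          rw [integral_add ((hA.integrable_inv h).const_mul _) (hqi.const_mul _),
            integral_const_mul, integral_const_mul, hq]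
      _ ≤ _ := by
          have := mul_le_mul_of_nonneg_left (hA.integral_inv_le h)
            (inner_meanDeriv_self_pos hX hL hA h ht).le
          simp only [hQ, hw]
          linarith
  refine ⟨I / (4 * C), by positivity, fun t => ?_⟩
  rcases eq_or_ne t 0 with rfl | ht
  · simp
  have h1 := hunit _ (norm_unitDir ht)
  have h2 : Q t = ‖t‖ ^ 2 * Q (unitDir t) := by
    simp only [hQ]
    conv_lhs => rw [← norm_smul_unitDir t]
    rw [map_smul, real_inner_smul_left, real_inner_smul_right]
    ring
  change I / (4 * C) * ‖t‖ ^ 2 ≤ Q t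
  rw [h2, mul_comm]
  refine mul_le_mul_of_nonneg_left ?_ (by positivity)
  rw [div_le_iff₀ (by positivity)]
  linarith

lemma inner_meanDir_sub_nonneg (hX : Measurable X) (h h' : H) :
    0 ≤ inner ℝ (meanDir μ X h - meanDir μ X h') (h - h') := by
  have hi : Integrable (fun ω => unitDir (X ω - h') - unitDir (X ω - h)) μ :=
    (integrable_unitDir hX _).sub (integrable_unitDir hX _)
  rw [meanDir, meanDir, neg_sub_neg, ← integral_sub (integrable_unitDir hX _)
    (integrable_unitDir hX _), real_inner_comm, ← integral_inner hi]
  refine integral_nonneg fun ω => ?_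
  have := inner_unitDir_sub_nonneg (X ω - h') (X ω - h)
  rwa [sub_sub_sub_cancel_left, real_inner_comm] at this

/-- The gradient points away from the median: quadratically near `m`, linearly far from it. -/
lemma exists_le_inner_meanDir (hX : Measurable X) (hL : NotOnLine μ X)
    (hA : InvMomentBound μ X C) {m : H} (hm : meanDir μ X m = 0) :
    ∃ c : ℝ, 0 < c ∧ ∀ A : ℝ, 1 ≤ A → ∀ h, ‖h - m‖ ≤ A →
      c * ‖h - m‖ ^ 2 ≤ A * inner ℝ (meanDir μ X h) (h - m) := by
  obtain ⟨l, hl, hQ⟩ := exists_le_inner_meanDeriv_self hX hL hA m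
  have hC := hA.pos
  -- Within this radius the second-order remainder `4 * C * ‖h - m‖ ^ 3` takes at most half of `l *
  -- ‖h - m‖ ^ 2`.
  set r := min 1 (l / (8 * C)) with hr
  have hr0 : 0 < r := by positivity
  have hr1 : r ≤ 1 := min_le_left _ _
  have hr2 : 4 * C * r ≤ l / 2 := by
    have : r ≤ l / (8 * C) := min_le_right _ _
    rw [le_div_iff₀ (by positivity)] at this
    linarith
  have hloc : ∀ h, ‖h - m‖ ≤ r → l / 2 * ‖h - m‖ ^ 2 ≤ inner ℝ (meanDir μ X h) (h - m) := by
    intro h hh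
    have h1 := norm_meanDir_sub_sub_le hX hA m h
    rw [hm, sub_zero] at h1
    have h2 := (abs_real_inner_le_norm (meanDir μ X h - meanDeriv μ X m (h - m)) (h - m)).trans
      (mul_le_mul_of_nonneg_right h1 (norm_nonneg _))
    rw [inner_sub_left] at h2
    have h3 := hQ (h - m)
    have h4 := (abs_le.1 h2).1
    have h5 : 4 * C * ‖h - m‖ ^ 2 * ‖h - m‖ ≤ l / 2 * ‖h - m‖ ^ 2 := by
      have : 4 * C * ‖h - m‖ ≤ l / 2 := le_trans (by gcongr) hr2
      nlinarith [sq_nonneg ‖h - m‖]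
    linarith
  refine ⟨l / 2 * r, by positivity, fun A hA1 h hh => ?_⟩
  rcases le_or_gt ‖h - m‖ r with h1 | h1
  · have h2 := hloc h h1
    have h3 : l / 2 * r * ‖h - m‖ ^ 2 ≤ l / 2 * ‖h - m‖ ^ 2 := by
      have : l / 2 * ‖h - m‖ ^ 2 * r ≤ l / 2 * ‖h - m‖ ^ 2 * 1 := by gcongr
      linarith
    have h4 : 0 ≤ inner ℝ (meanDir μ X h) (h - m) := le_trans (by positivity) h2
    nlinarith
  · have hpos : 0 < ‖h - m‖ := hr0.trans h1
    -- Beyond radius `r`, monotonicity of the gradient compares `h` with the point of the segment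
    -- `[m, h]` at distance `r` from `m`. The drift is then at least linear in `‖h - m‖`, and `‖h -
    -- m‖ ≤ A` converts this into the quadratic bound.
    set s := r / ‖h - m‖ with hs
    have hs0 : 0 < s := by positivity
    have hs1 : s < 1 := (div_lt_one hpos).2 h1
    have hsr : s * ‖h - m‖ = r := div_mul_cancel₀ _ hpos.ne'
    have h2 := hloc (m + s • (h - m)) (by
      rw [add_sub_cancel_left, norm_smul, Real.norm_eq_abs, abs_of_pos hs0, hsr])
    rw [add_sub_cancel_left, norm_smul, Real.norm_eq_abs, abs_of_pos hs0, hsr,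
      real_inner_smul_right] at h2
    have h3 := inner_meanDir_sub_nonneg (μ := μ) hX h (m + s • (h - m))
    rw [show h - (m + s • (h - m)) = (1 - s) • (h - m) by module, real_inner_smul_right,
      inner_sub_left] at h3
    have h4 := (mul_nonneg_iff_of_pos_left (by linarith : 0 < 1 - s)).1 h3
    have h5 : l / 2 * r * ‖h - m‖ ≤ inner ℝ (meanDir μ X h) (h - m) := by
      refine le_of_mul_le_mul_left ?_ hs0
      calc s * (l / 2 * r * ‖h - m‖) = l / 2 * r ^ 2 := by
            rw [show s * (l / 2 * r * ‖h - m‖) = l / 2 * r * (s * ‖h - m‖) by ring, hsr]; ring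
        _ ≤ _ := h2
        _ ≤ _ := mul_le_mul_of_nonneg_left (by linarith) hs0.le
    calc l / 2 * r * ‖h - m‖ ^ 2 = ‖h - m‖ * (l / 2 * r * ‖h - m‖) := by ring
      _ ≤ A * inner ℝ (meanDir μ X h) (h - m) := by gcongr

end Convexity

/-! ### Deterministic recursive inequalities. -/

section Sequences

/-- The induction multiplies by `1 + y`, whence `-1 ≤ y`; the upper bound on `y` absorbs the cubic
term. -/
lemma exists_one_add_pow_le (K : ℝ) (hK : 0 ≤ K) (q : ℕ) :
    ∃ C : ℝ, 0 ≤ C ∧ ∀ y : ℝ, -1 ≤ y → y ≤ K → (1 + y) ^ q ≤ 1 + q * y + C * y ^ 2 := by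
  induction q with
  | zero => exact ⟨0, le_rfl, fun y _ _ => by simp⟩
  | succ q ih =>
    obtain ⟨C, hC, h⟩ := ih
    refine ⟨q + C * (1 + K), by positivity, fun y h1 h2 => ?_⟩
    have h3 := mul_le_mul_of_nonneg_right (h y h1 h2) (by linarith : 0 ≤ 1 + y)
    have h4 : C * y ^ 2 * y ≤ C * y ^ 2 * K := mul_le_mul_of_nonneg_left h2 (by positivity)
    rw [pow_succ]
    push_cast
    nlinarith

/-- A sequence contracted by `1 - c n^{-β}` with `β < 1` follows its perturbation. -/
lemma exists_le_rpow_of_contraction {a : ℕ → ℝ} {β κ c C : ℝ} (hβ : β < 1) (hβ0 : 0 < β)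
    (hκ : 0 < κ)
    (hc : 0 < c) (ha : ∀ k, 0 ≤ a k)
    (h : ∀ k : ℕ, a (k + 1) ≤ (1 - c * ((k : ℝ) + 1) ^ (-β)) * a k
      + C * (((k : ℝ) + 1) ^ (-β) * ((k : ℝ) + 1) ^ (-κ))) :
    ∃ K : ℝ, 0 ≤ K ∧ ∀ k : ℕ, a k ≤ K * ((k : ℝ) + 1) ^ (-κ) := by
  have hcast : Tendsto (fun k : ℕ => (k : ℝ) + 1) atTop atTop :=
    tendsto_atTop_add_const_right _ _ tendsto_natCast_atTop_atTop
  have t1 : Tendsto (fun k : ℕ => c * ((k : ℝ) + 1) ^ (-β)) atTop (nhds 0) := by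
    simpa using ((tendsto_rpow_neg_atTop hβ0).comp hcast).const_mul c
  -- As `β < 1`, the relative decrease `κ / x` of the target `x ^ (-κ)` is eventually below half the
  -- contraction rate `c * x ^ (-β)`.
  have t2 : Tendsto (fun k : ℕ => κ * ((k : ℝ) + 1) ^ (-(1 - β))) atTop (nhds 0) := by
    simpa using ((tendsto_rpow_neg_atTop (sub_pos.2 hβ)).comp hcast).const_mul κ
  obtain ⟨N, hN⟩ := eventually_atTop.1
    ((t1.eventually (gt_mem_nhds one_pos)).and (t2.eventually (gt_mem_nhds (half_pos hc))))
  -- The first summand lets half of the contraction absorb the perturbation; the finite sum covers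
  -- the indices up to `N`.
  set K := 2 * |C| / c + ∑ k ∈ Finset.range (N + 1), a k * ((k : ℝ) + 1) ^ κ with hK
  have hsum : 0 ≤ ∑ k ∈ Finset.range (N + 1), a k * ((k : ℝ) + 1) ^ κ :=
    Finset.sum_nonneg fun k _ => mul_nonneg (ha k) (by positivity)
  have hK0 : 0 ≤ K := by positivity
  have hKC : C ≤ K * (c / 2) := by
    have : 2 * |C| / c * (c / 2) = |C| := by field_simp
    nlinarith [le_abs_self C]
  refine ⟨K, hK0, fun k => ?_⟩
  have hsmall : ∀ k ≤ N, a k ≤ K * ((k : ℝ) + 1) ^ (-κ) := by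
    intro k hk
    rw [Real.rpow_neg (by positivity), ← div_eq_mul_inv, le_div_iff₀ (by positivity)]
    have h1 : a k * ((k : ℝ) + 1) ^ κ ≤
        ∑ k ∈ Finset.range (N + 1), a k * ((k : ℝ) + 1) ^ κ :=
      Finset.single_le_sum (f := fun k : ℕ => a k * ((k : ℝ) + 1) ^ κ)
        (fun k _ => mul_nonneg (ha k) (by positivity)) (Finset.mem_range.2 (by omega))
    have : 0 ≤ 2 * |C| / c := by positivity
    linarith
  rcases le_total k N with hk | hk
  · exact hsmall k hk
  induction k, hk using Nat.le_induction with
  | base => exact hsmall N le_rfl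
  | succ k hk ih =>
    obtain ⟨h1, h2⟩ := hN k hk
    set x : ℝ := (k : ℝ) + 1 with hx
    have hx0 : 0 < x := by positivity
    have hx1 : 1 ≤ x := by rw [hx]; linarith [(Nat.cast_nonneg k : (0 : ℝ) ≤ k)]
    have h3 : x ^ (-κ) * (1 - κ * x⁻¹) ≤ (x + 1) ^ (-κ) := by
      have hb : 1 - κ * x⁻¹ ≤ (1 + x⁻¹) ^ (-κ) := by
        have hle : 1 + x⁻¹ ≤ Real.exp x⁻¹ := by linarith [Real.add_one_le_exp x⁻¹]
        have := Real.rpow_le_rpow_of_nonpos (by positivity) hle (neg_nonpos.2 hκ.le)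
        rw [← Real.exp_mul] at this
        linarith [Real.add_one_le_exp (x⁻¹ * -κ)]
      have he : x + 1 = x * (1 + x⁻¹) := by field_simp
      rw [he, Real.mul_rpow hx0.le (by positivity)]
      exact mul_le_mul_of_nonneg_left hb (by positivity)
    have h4 : x ^ (-(1 - β)) = x ^ β * x⁻¹ := by
      rw [← Real.rpow_neg_one x, ← Real.rpow_add hx0]; congr 1; ring
    have h5 : x ^ (-β) * x ^ β = 1 := by
      rw [← Real.rpow_add hx0]; simp
    have h6 : κ * x⁻¹ ≤ c / 2 * x ^ (-β) := by
      rw [h4] at h2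
      have := mul_le_mul_of_nonneg_left h2.le (by positivity : 0 ≤ x ^ (-β))
      calc κ * x⁻¹ = x ^ (-β) * (κ * (x ^ β * x⁻¹)) := by
            rw [show x ^ (-β) * (κ * (x ^ β * x⁻¹)) = (x ^ (-β) * x ^ β) * (κ * x⁻¹) by ring, h5,
              one_mul]
        _ ≤ _ := by linarith
    have h7 : 0 < x ^ (-κ) := by positivity
    have h8 : 0 < x ^ (-β) := by positivity
    push_cast
    rw [← hx]
    calc a (k + 1) ≤ (1 - c * x ^ (-β)) * a k + C * (x ^ (-β) * x ^ (-κ)) := h k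
      _ ≤ (1 - c * x ^ (-β)) * (K * x ^ (-κ)) + K * (c / 2) * (x ^ (-β) * x ^ (-κ)) := by
          have h1' : 0 ≤ 1 - c * x ^ (-β) := by linarith
          gcongr
      _ = K * (x ^ (-κ) * (1 - c / 2 * x ^ (-β))) := by ring
      _ ≤ K * (x ^ (-κ) * (1 - κ * x⁻¹)) := by gcongr
      _ ≤ K * (x + 1) ^ (-κ) := by gcongr

/-- Discrete Gronwall inequality: the product of the factors is at most the exponential of the
convergent sum. -/
lemma exists_le_of_le_one_add_mul {b u : ℕ → ℝ} {K : ℝ} (hK : 0 ≤ K) (hb : ∀ k, 0 ≤ b k)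
    (hu : ∀ k, 0 ≤ u k) (hs : Summable u) (h : ∀ k, b (k + 1) ≤ (1 + K * u k) * b k) :
    ∃ M, ∀ k, b k ≤ M := by
  have h1 : ∀ k, b k ≤ Real.exp (K * ∑ j ∈ Finset.range k, u j) * b 0 := by
    intro k
    induction k with
    | zero => simp
    | succ k ih =>
      rw [Finset.sum_range_succ, mul_add, add_comm (K * _), Real.exp_add, mul_assoc]
      refine (h k).trans (mul_le_mul ?_ ih (hb k) (Real.exp_pos _).le)
      linarith [Real.add_one_le_exp (K * u k)]
  refine ⟨Real.exp (K * ∑' j, u j) * b 0, fun k => (h1 k).trans ?_⟩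
  have := hs.sum_le_tsum (Finset.range k) (fun j _ => hu j)
  have := hb 0
  gcongr

end Sequences

/-! ### Almost surely bounded variables, a class stable under the operations used, which makes
integrability automatic. -/

section Bounded

variable {Ω E : Type*} [MeasurableSpace Ω] [NormedAddCommGroup E]

/-- A strongly measurable random variable which is almost surely bounded. -/
def AEBounded (μ : Measure Ω) (Y : Ω → E) : Prop :=
  AEStronglyMeasurable Y μ ∧ ∃ M : ℝ, ∀ᵐ ω ∂μ, ‖Y ω‖ ≤ M

namespace AEBounded

variable {μ : Measure Ω} {Y Z : Ω → E}

lemma of_norm_le (hY : AEStronglyMeasurable Y μ) (M : ℝ) (h : ∀ ω, ‖Y ω‖ ≤ M) : AEBounded μ Y :=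
  ⟨hY, M, Eventually.of_forall h⟩

lemma const (c : E) : AEBounded μ (fun _ : Ω => c) :=
  of_norm_le aestronglyMeasurable_const ‖c‖ fun _ => le_rfl

lemma add (hY : AEBounded μ Y) (hZ : AEBounded μ Z) : AEBounded μ fun ω => Y ω + Z ω := by
  obtain ⟨h1, M, h2⟩ := hY
  obtain ⟨h3, N, h4⟩ := hZ
  refine ⟨h1.add h3, M + N, ?_⟩
  filter_upwards [h2, h4] with ω h5 h6 using (norm_add_le _ _).trans (add_le_add h5 h6)

lemma neg (hY : AEBounded μ Y) : AEBounded μ fun ω => -Y ω := by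
  obtain ⟨h1, M, h2⟩ := hY
  exact ⟨h1.neg, M, by simpa using h2⟩

lemma sub (hY : AEBounded μ Y) (hZ : AEBounded μ Z) : AEBounded μ fun ω => Y ω - Z ω := by
  simpa only [sub_eq_add_neg] using hY.add hZ.neg

lemma norm (hY : AEBounded μ Y) : AEBounded μ fun ω => ‖Y ω‖ := by
  obtain ⟨h1, M, h2⟩ := hY
  exact ⟨h1.norm, M, by simpa using h2⟩

lemma smul [NormedSpace ℝ E] {f : Ω → ℝ} (hf : AEBounded μ f) (hY : AEBounded μ Y) :
    AEBounded μ fun ω => f ω • Y ω := by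
  obtain ⟨h1, M, h2⟩ := hf
  obtain ⟨h3, N, h4⟩ := hY
  refine ⟨h1.smul h3, M * N, ?_⟩
  filter_upwards [h2, h4] with ω h5 h6
  rw [norm_smul]
  exact mul_le_mul h5 h6 (norm_nonneg _) ((norm_nonneg _).trans h5)

lemma const_smul [NormedSpace ℝ E] (c : ℝ) (hY : AEBounded μ Y) : AEBounded μ fun ω => c • Y ω :=
  (const c).smul hY

lemma mul {f g : Ω → ℝ} (hf : AEBounded μ f) (hg : AEBounded μ g) :
    AEBounded μ fun ω => f ω * g ω := hf.smul hg

lemma const_mul {f : Ω → ℝ} (c : ℝ) (hf : AEBounded μ f) : AEBounded μ fun ω => c * f ω :=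
  (const c).mul hf

lemma pow {f : Ω → ℝ} (hf : AEBounded μ f) (n : ℕ) : AEBounded μ fun ω => f ω ^ n := by
  induction n with
  | zero => simpa using const (μ := μ) (1 : ℝ)
  | succ n ih => simpa only [pow_succ] using ih.mul hf

lemma inner [InnerProductSpace ℝ E] (hY : AEBounded μ Y) (hZ : AEBounded μ Z) :
    AEBounded μ fun ω => Inner.inner ℝ (Y ω) (Z ω) := by
  obtain ⟨h1, M, h2⟩ := hY
  obtain ⟨h3, N, h4⟩ := hZ
  refine ⟨h1.inner h3, M * N, ?_⟩
  filter_upwards [h2, h4] with ω h5 h6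
  exact (norm_inner_le_norm _ _).trans
    (mul_le_mul h5 h6 (norm_nonneg _) ((norm_nonneg _).trans h5))

lemma sum {ι : Type*} (s : Finset ι) {Y : ι → Ω → E} (hY : ∀ i ∈ s, AEBounded μ (Y i)) :
    AEBounded μ fun ω => ∑ i ∈ s, Y i ω := by
  classical
  induction s using Finset.induction_on with
  | empty => simpa using const (μ := μ) (0 : E)
  | insert i s hi ih =>
    simp only [Finset.sum_insert hi]
    exact (hY i (by simp)).add (ih fun j hj => hY j (by simp [hj]))

lemma clm [NormedSpace ℝ E] {F : Type*} [NormedAddCommGroup F] [NormedSpace ℝ F] (L : E →L[ℝ] F)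
    (hY : AEBounded μ Y) : AEBounded μ fun ω => L (Y ω) := by
  obtain ⟨h1, M, h2⟩ := hY
  refine ⟨L.continuous.comp_aestronglyMeasurable h1, ‖L‖ * M, ?_⟩
  filter_upwards [h2] with ω h3
  exact (L.le_opNorm _).trans (mul_le_mul_of_nonneg_left h3 (norm_nonneg _))

lemma integrable [IsFiniteMeasure μ] (hY : AEBounded μ Y) : Integrable Y μ := by
  obtain ⟨h1, M, h2⟩ := hY
  exact Integrable.of_bound h1 M h2

end AEBounded

end Bounded

/-! ### Averaging over a variable independent of the past. -/

section Freezing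

variable {Ω H : Type*} {F mΩ : MeasurableSpace Ω} [NormedAddCommGroup H] [InnerProductSpace ℝ H]
  [MeasurableSpace H] [BorelSpace H] [TopologicalSpace.SeparableSpace H] [CompleteSpace H]
  {μ : Measure Ω} [IsProbabilityMeasure μ] {X : Ω → H} {C : ℝ}
  {x : Ω → H} {B z : Ω → H}

lemma map_prod_eq_of_indep (hF : F ≤ mΩ) (hlaw : IdentDistrib x X μ μ)
    (hind : Indep F (MeasurableSpace.comap x inferInstance) μ)
    {E : Type*} [MeasurableSpace E] {W : Ω → E} (hW : Measurable[F] W) :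
    μ.map (fun ω => (W ω, x ω)) = (μ.map W).prod (μ.map X) := by
  have h : IndepFun W x μ := indep_of_indep_of_le_left hind hW.comap_le
  rw [(indepFun_iff_map_prod_eq_prod_map_map (hW.mono hF le_rfl).aemeasurable
    hlaw.aemeasurable_fst).1 h, hlaw.map_eq]

/-- This says that the conditional mean of the direction given the past is `-meanDir μ X z`, tested
against a past vector `B`. By independence the joint law is a product, and Fubini integrates over
`x` with `B` and `z` frozen. -/
lemma integral_inner_unitDir (hX : Measurable X) (hx : Measurable x) (hF : F ≤ mΩ)
    (hlaw : IdentDistrib x X μ μ) (hind : Indep F (MeasurableSpace.comap x inferInstance) μ)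
    (hB : Measurable[F] B) (hz : Measurable[F] z) (hb : AEBounded μ B) :
    ∫ ω, inner ℝ (B ω) (unitDir (x ω - z ω)) ∂μ = -∫ ω, inner ℝ (B ω) (meanDir μ X (z ω)) ∂μ := by
  have hW : Measurable[F] fun ω => (B ω, z ω) := hB.prodMk hz
  have hW' : Measurable fun ω => (B ω, z ω) := hW.mono hF le_rfl
  have hmap := map_prod_eq_of_indep hF hlaw hind hW
  set φ : (H × H) × H → ℝ := fun p => inner ℝ p.1.1 (unitDir (p.2 - p.1.2)) with hφ
  have hφm : Measurable φ := by
    have : Measurable fun p : (H × H) × H => unitDir (p.2 - p.1.2) :=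
      measurable_unitDir.comp (by fun_prop)
    exact Measurable.inner (by fun_prop) this
  have hpm : Measurable fun ω => ((B ω, z ω), x ω) := hW'.prodMk hx
  have hi : Integrable (fun ω => φ ((B ω, z ω), x ω)) μ := by
    refine AEBounded.integrable (hb.inner (Z := fun ω => unitDir (x ω - z ω)) ?_)
    refine AEBounded.of_norm_le ?_ 1 fun ω => norm_unitDir_le _
    exact (measurable_unitDir.comp (hx.sub (hz.mono hF le_rfl))).aestronglyMeasurable
  have hi2 : Integrable φ ((μ.map fun ω => (B ω, z ω)).prod (μ.map X)) := by
    rw [← hmap]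
    exact (integrable_map_measure hφm.aestronglyMeasurable hpm.aemeasurable).2 hi
  have := Measure.isProbabilityMeasure_map hX.aemeasurable (μ := μ)
  calc ∫ ω, inner ℝ (B ω) (unitDir (x ω - z ω)) ∂μ
      = ∫ p, φ p ∂(μ.map fun ω => ((B ω, z ω), x ω)) :=
        (integral_map hpm.aemeasurable hφm.aestronglyMeasurable).symm
    _ = ∫ w, ∫ y, φ (w, y) ∂(μ.map X) ∂(μ.map fun ω => (B ω, z ω)) := by
        rw [hmap, integral_prod _ hi2]
    _ = ∫ ω, ∫ y, φ ((B ω, z ω), y) ∂(μ.map X) ∂μ :=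
        integral_map hW'.aemeasurable
          (hφm.stronglyMeasurable.integral_prod_right (ν := μ.map X)).aestronglyMeasurable
    _ = ∫ ω, -inner ℝ (B ω) (meanDir μ X (z ω)) ∂μ := by
        refine integral_congr_ae (Eventually.of_forall fun ω => ?_)
        simp only [hφ]
        rw [integral_map hX.aemeasurable (by
            exact (hφm.comp (measurable_prodMk_left (x := (B ω, z ω)))).aestronglyMeasurable),
          integral_inner (integrable_unitDir hX (z ω)), meanDir, inner_neg_right, neg_neg]
    _ = _ := integral_neg _

/-- The law of `X` has no atoms, so the diagonal is null for the product law. -/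
lemma ae_ne_of_indep (hX : Measurable X) (hA : InvMomentBound μ X C) (hx : Measurable x)
    (hF : F ≤ mΩ) (hlaw : IdentDistrib x X μ μ)
    (hind : Indep F (MeasurableSpace.comap x inferInstance) μ) (hz : Measurable[F] z) :
    ∀ᵐ ω ∂μ, x ω ≠ z ω := by
  have hz' : Measurable z := hz.mono hF le_rfl
  have hmap := map_prod_eq_of_indep hF hlaw hind hz
  have hs : MeasurableSet {p : H × H | p.2 = p.1} :=
    measurableSet_eq_fun measurable_snd measurable_fst
  have h1 : (μ.map fun ω => (z ω, x ω)) {p : H × H | p.2 = p.1} = 0 := by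
    rw [hmap, Measure.measure_prod_null hs]
    refine Eventually.of_forall fun a => ?_
    simp only [Pi.zero_apply]
    rw [Measure.map_apply hX (measurable_prodMk_left hs)]
    have := hA.ne a
    rw [ae_iff] at this
    change μ {ω | X ω = a} = 0
    simpa using this
  rw [Measure.map_apply (hz'.prodMk hx) hs] at h1
  rw [ae_iff]
  simpa using h1

end Freezing

/-! ### Moment estimates for the stochastic recursion. -/

section Recursion

variable {Ω H : Type*} [mΩ : MeasurableSpace Ω] [NormedAddCommGroup H] [InnerProductSpace ℝ H]
  [MeasurableSpace H]

/-- The stochastic gradient recursion `z_{k+1} = z_k + g_k (x_k - z_k) / ‖x_k - z_k‖`, with `x_k`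
of the law of `X` and independent of the past `F_k`, to which `z_k` is adapted. -/
structure GradientRecursion (μ : Measure Ω) (X : Ω → H) (g : ℕ → ℝ) (F : ℕ → MeasurableSpace Ω)
    (x z : ℕ → Ω → H) : Prop where
  le : ∀ k, F k ≤ mΩ
  mono : Monotone F
  measurable_z : ∀ k, Measurable[F k] (z k)
  measurable_x : ∀ k, Measurable[F (k + 1)] (x k)
  law : ∀ k, IdentDistrib (x k) X μ μ
  indep : ∀ k, Indep (F k) (MeasurableSpace.comap (x k) inferInstance) μ
  bounded : AEBounded μ (z 0)
  succ : ∀ k ω, z (k + 1) ω = z k ω + g k • unitDir (x k ω - z k ω)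

namespace GradientRecursion

variable [BorelSpace H] [TopologicalSpace.SeparableSpace H] [CompleteSpace H]
  {μ : Measure Ω} [IsProbabilityMeasure μ] {X : Ω → H} {C : ℝ} {g : ℕ → ℝ}
  {F : ℕ → MeasurableSpace Ω} {x z : ℕ → Ω → H} {m : H}

lemma measurable_z' (hR : GradientRecursion μ X g F x z) (k : ℕ) : Measurable (z k) :=
  (hR.measurable_z k).mono (hR.le k) le_rfl

lemma measurable_x' (hR : GradientRecursion μ X g F x z) (k : ℕ) : Measurable (x k) :=
  (hR.measurable_x k).mono (hR.le _) le_rfl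

lemma aebounded_dir (hR : GradientRecursion μ X g F x z) (k : ℕ) :
    AEBounded μ fun ω => unitDir (x k ω - z k ω) :=
  AEBounded.of_norm_le (measurable_unitDir.comp
    ((hR.measurable_x' k).sub (hR.measurable_z' k))).aestronglyMeasurable 1
    fun _ => norm_unitDir_le _

lemma aebounded_z (hR : GradientRecursion μ X g F x z) (k : ℕ) : AEBounded μ (z k) := by
  induction k with
  | zero => exact hR.bounded
  | succ k ih => rw [funext (hR.succ k)]; exact ih.add ((hR.aebounded_dir k).const_smul _)

lemma aebounded_dev (hR : GradientRecursion μ X g F x z) (k : ℕ) :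
    AEBounded μ fun ω => z k ω - m :=
  (hR.aebounded_z k).sub (AEBounded.const m)

lemma aebounded_meanDir (hR : GradientRecursion μ X g F x z) (hX : Measurable X)
    (hA : InvMomentBound μ X C) (k : ℕ) : AEBounded μ fun ω => meanDir μ X (z k ω) :=
  AEBounded.of_norm_le ((continuous_meanDir hX hA).measurable.comp
    (hR.measurable_z' k)).aestronglyMeasurable 1 fun _ => norm_meanDir_le _

lemma integral_inner_dir (hR : GradientRecursion μ X g F x z) (hX : Measurable X) (k : ℕ)
    {B : Ω → H} (hB : Measurable[F k] B) (hb : AEBounded μ B) :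
    ∫ ω, inner ℝ (B ω) (unitDir (x k ω - z k ω)) ∂μ =
      -∫ ω, inner ℝ (B ω) (meanDir μ X (z k ω)) ∂μ :=
  integral_inner_unitDir hX (hR.measurable_x' k) (hR.le k) (hR.law k) (hR.indep k) hB
    (hR.measurable_z k) hb

/-- Increments along a nonnegative multiple of the deviation are controlled by the drift. -/
lemma integral_mul_inner_dir (hR : GradientRecursion μ X g F x z) (hX : Measurable X) (k : ℕ)
    {f : ℝ → ℝ} (hf : Measurable f) (hb : AEBounded μ fun ω => f ‖z k ω - m‖) :
    ∫ ω, f ‖z k ω - m‖ * inner ℝ (z k ω - m) (unitDir (x k ω - z k ω)) ∂μ =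
      -∫ ω, f ‖z k ω - m‖ * inner ℝ (z k ω - m) (meanDir μ X (z k ω)) ∂μ := by
  have hz := hR.measurable_z k
  have hT : Measurable[F k] fun ω => z k ω - m := hz.sub_const m
  have hφ : Measurable fun h : H => f ‖h‖ • h := (hf.comp measurable_norm).smul measurable_id
  have hB : Measurable[F k] fun ω => f ‖z k ω - m‖ • (z k ω - m) := hφ.comp hT
  have := hR.integral_inner_dir hX k hB (hb.smul (hR.aebounded_dev k))
  simpa only [real_inner_smul_left] using this

lemma inner_dev_meanDir_nonneg (hX : Measurable X) (hm : meanDir μ X m = 0) (h : H) :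
    0 ≤ inner ℝ (h - m) (meanDir μ X h) := by
  have := inner_meanDir_sub_nonneg (μ := μ) hX h m
  rwa [hm, sub_zero, real_inner_comm] at this

lemma norm_succ_sq (hR : GradientRecursion μ X g F x z) (k : ℕ) (ω : Ω) :
    ‖z (k + 1) ω - m‖ ^ 2 = ‖z k ω - m‖ ^ 2
      + 2 * g k * inner ℝ (z k ω - m) (unitDir (x k ω - z k ω))
      + g k ^ 2 * ‖unitDir (x k ω - z k ω)‖ ^ 2 := by
  rw [hR.succ, add_sub_right_comm, norm_add_sq_real, real_inner_smul_right, norm_smul, mul_pow,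
    Real.norm_eq_abs, sq_abs]
  ring

/-- All moments of the deviations are bounded when the squares of the steps are summable. -/
lemma exists_moment_le (hR : GradientRecursion μ X g F x z) (hX : Measurable X)
    (hm : meanDir μ X m = 0) (hg : ∀ k, 0 ≤ g k)
    (hs : Summable fun k => g k ^ 2) (q : ℕ) :
    ∃ K, ∀ k, ∫ ω, (1 + ‖z k ω - m‖ ^ 2) ^ (q + 1) ∂μ ≤ K := by
  obtain ⟨G, hG0, hG⟩ : ∃ G, 0 ≤ G ∧ ∀ k, g k ≤ G := by
    -- From `t ≤ t ^ 2 + 1`.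
    refine ⟨∑' k, g k ^ 2 + 1, by positivity, fun k => ?_⟩
    have := hs.le_tsum k fun j _ => sq_nonneg (g j)
    nlinarith [sq_nonneg (g k - 1)]
  obtain ⟨D, hD0, hD⟩ := exists_one_add_pow_le (G * (1 + G)) (by positivity) (q + 1)
  refine exists_le_of_le_one_add_mul (u := fun k => g k ^ 2)
    (K := (q + 1 : ℕ) + D * (1 + G) ^ 2) (by positivity)
    (fun k => integral_nonneg fun ω => by positivity) (fun k => sq_nonneg _) hs fun k => ?_
  have hpt : ∀ ω, (1 + ‖z (k + 1) ω - m‖ ^ 2) ^ (q + 1) ≤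
      (1 + ((q + 1 : ℕ) + D * (1 + G) ^ 2) * g k ^ 2) * (1 + ‖z k ω - m‖ ^ 2) ^ (q + 1)
      + 2 * (q + 1 : ℕ) * g k * ((1 + ‖z k ω - m‖ ^ 2) ^ q *
        inner ℝ (z k ω - m) (unitDir (x k ω - z k ω))) := by
    intro ω
    have hsucc := hR.norm_succ_sq (m := m) k ω
    set r := ‖z k ω - m‖ with hr
    set s := inner ℝ (z k ω - m) (unitDir (x k ω - z k ω)) with hs
    set u := ‖unitDir (x k ω - z k ω)‖ with hu
    have hu1 : u ≤ 1 := norm_unitDir_le _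
    have hu0 : 0 ≤ u := norm_nonneg _
    have hr0 : 0 ≤ r := norm_nonneg _
    have hsr : |s| ≤ r := (abs_real_inner_le_norm _ _).trans
      (mul_le_of_le_one_right (norm_nonneg _) (norm_unitDir_le _))
    have hW : 0 < 1 + r ^ 2 := by positivity
    -- The relative increment of `1 + ‖z k - m‖ ^ 2`. It is `O(g k)` because `2 * r ≤ 1 + r ^ 2`, so
    -- its square is summable; the linear term keeps the inner product whose mean is nonpositive.
    set y := (2 * g k * s + g k ^ 2 * u ^ 2) / (1 + r ^ 2) with hy
    have hyW : (1 + r ^ 2) * y = 2 * g k * s + g k ^ 2 * u ^ 2 := by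
      rw [hy]; field_simp
    have hgk := hg k
    have hu2 : u ^ 2 ≤ 1 := pow_le_one₀ hu0 hu1
    have habs : |y| ≤ g k * (1 + G) := by
      rw [hy, abs_div, abs_of_pos hW, div_le_iff₀ hW]
      have h1 : |2 * g k * s + g k ^ 2 * u ^ 2| ≤ 2 * g k * r + g k ^ 2 := by
        refine (abs_add_le _ _).trans (add_le_add ?_ ?_)
        · rw [abs_mul, abs_of_nonneg (by positivity : 0 ≤ 2 * g k)]
          gcongr
        · rw [abs_of_nonneg (by positivity)]
          exact mul_le_of_le_one_right (by positivity) hu2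
      refine h1.trans ?_
      have h2 : g k * g k ≤ g k * G := mul_le_mul_of_nonneg_left (hG k) hgk
      have h3 : 0 ≤ g k * (1 - r) ^ 2 := by positivity
      have h4 : 0 ≤ g k * G * r ^ 2 := by positivity
      nlinarith
    have hy1 : -1 ≤ y := by
      have h1 : 0 ≤ (1 + r ^ 2) * (1 + y) := by
        rw [mul_add, hyW, mul_one]
        have : 0 ≤ ‖z (k + 1) ω - m‖ ^ 2 := by positivity
        linarith
      have := (mul_nonneg_iff_of_pos_left hW).1 h1
      linarith
    have hy2 : y ≤ G * (1 + G) := (le_abs_self y).trans (habs.trans (by gcongr; exact hG k))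
    have hy3 : y ^ 2 ≤ g k ^ 2 * (1 + G) ^ 2 := by
      rw [← sq_abs, ← mul_pow]; gcongr
    have h5 : 1 + ‖z (k + 1) ω - m‖ ^ 2 = (1 + r ^ 2) * (1 + y) := by
      rw [hsucc, mul_add, hyW]; ring
    have h6 : (1 + r ^ 2) ^ q * (g k ^ 2 * u ^ 2) ≤ (1 + r ^ 2) ^ (q + 1) * g k ^ 2 := by
      have h7 : (1 + r ^ 2) ^ q ≤ (1 + r ^ 2) ^ (q + 1) :=
        pow_le_pow_right₀ (by nlinarith) (Nat.le_succ q)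
      exact mul_le_mul h7 (mul_le_of_le_one_right (by positivity) hu2) (by positivity)
        (by positivity)
    rw [h5, mul_pow]
    calc (1 + r ^ 2) ^ (q + 1) * (1 + y) ^ (q + 1)
        ≤ (1 + r ^ 2) ^ (q + 1) * (1 + (q + 1 : ℕ) * y + D * (g k ^ 2 * (1 + G) ^ 2)) := by
          refine mul_le_mul_of_nonneg_left ?_ (by positivity)
          have := hD y hy1 hy2
          have := mul_le_mul_of_nonneg_left hy3 hD0
          linarith
      _ = (1 + r ^ 2) ^ (q + 1) * (1 + D * (g k ^ 2 * (1 + G) ^ 2))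
          + (q + 1 : ℕ) * ((1 + r ^ 2) ^ q * ((1 + r ^ 2) * y)) := by ring
      _ = (1 + r ^ 2) ^ (q + 1) * (1 + D * (g k ^ 2 * (1 + G) ^ 2))
          + (q + 1 : ℕ) * ((1 + r ^ 2) ^ q * (2 * g k * s) + (1 + r ^ 2) ^ q * (g k ^ 2 * u ^ 2)) := by
          rw [hyW]; ring
      _ ≤ (1 + r ^ 2) ^ (q + 1) * (1 + D * (g k ^ 2 * (1 + G) ^ 2))
          + (q + 1 : ℕ) * ((1 + r ^ 2) ^ q * (2 * g k * s) + (1 + r ^ 2) ^ (q + 1) * g k ^ 2) := by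
          gcongr
      _ = _ := by ring
  have hT := fun k => hR.aebounded_dev (m := m) k
  have hV : ∀ k n, AEBounded μ fun ω => (1 + ‖z k ω - m‖ ^ 2) ^ n := fun k n =>
    ((AEBounded.const 1).add ((hT k).norm.pow 2)).pow n
  have hI1 := (hV k (q + 1)).integrable
  have hI2 := ((hV k q).mul ((hT k).inner (hR.aebounded_dir k))).integrable
  have hdrift := hR.integral_mul_inner_dir (m := m) hX k (f := fun r => (1 + r ^ 2) ^ q)
    (by fun_prop) (hV k q)
  have hnonneg : 0 ≤ ∫ ω, (1 + ‖z k ω - m‖ ^ 2) ^ q *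
      inner ℝ (z k ω - m) (meanDir μ X (z k ω)) ∂μ :=
    integral_nonneg fun ω => mul_nonneg (by positivity) (inner_dev_meanDir_nonneg hX hm _)
  calc _ ≤ ∫ ω, ((1 + ((q + 1 : ℕ) + D * (1 + G) ^ 2) * g k ^ 2)
          * (1 + ‖z k ω - m‖ ^ 2) ^ (q + 1)
        + 2 * (q + 1 : ℕ) * g k * ((1 + ‖z k ω - m‖ ^ 2) ^ q *
          inner ℝ (z k ω - m) (unitDir (x k ω - z k ω)))) ∂μ :=
        integral_mono (hV (k + 1) (q + 1)).integrable ((hI1.const_mul _).add (hI2.const_mul _)) hpt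
    _ ≤ _ := by
        rw [integral_add (hI1.const_mul _) (hI2.const_mul _), integral_const_mul,
          integral_const_mul, hdrift]
        have := mul_nonneg (by have := hg k; positivity : 0 ≤ 2 * ((q + 1 : ℕ) : ℝ) * g k) hnonneg
        linarith

/-- One step of the recursion for the fourth moment of the deviation, after truncation of the drift
at the level `A`. -/
lemma fourth_moment_succ_le (hR : GradientRecursion μ X g F x z) (hX : Measurable X)
    (hA : InvMomentBound μ X C) (hm : meanDir μ X m = 0) {c : ℝ} (hc : 0 < c)
    (hdrift : ∀ A : ℝ, 1 ≤ A → ∀ h, ‖h - m‖ ≤ A →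
      c * ‖h - m‖ ^ 2 ≤ A * inner ℝ (meanDir μ X h) (h - m))
    (N k : ℕ) (hg : 0 < g k) {A K : ℝ} (hA1 : 1 ≤ A)
    (hK : ∫ ω, (1 + ‖z k ω - m‖ ^ 2) ^ (N + 2) ∂μ ≤ K) :
    ∫ ω, ‖z (k + 1) ω - m‖ ^ 4 ∂μ ≤ (1 - 3 * c * (g k / A)) * ∫ ω, ‖z k ω - m‖ ^ 4 ∂μ
      + (4 * c * K * (g k / A) * (A ^ (2 * N))⁻¹ + 16 / c * (g k ^ 3 * A) + 3 * g k ^ 4) := by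
  have hA0 : 0 < A := one_pos.trans_le hA1
  have hT := fun k => hR.aebounded_dev (m := m) k
  have hI4 := fun k => ((hT k).norm.pow 4).integrable
  have hIN : Integrable (fun ω => (1 + ‖z k ω - m‖ ^ 2) ^ (N + 2)) μ :=
    (((AEBounded.const 1).add ((hT k).norm.pow 2)).pow (N + 2)).integrable
  have hIU := (((hT k).norm.pow 2).mul ((hT k).inner (hR.aebounded_dir k))).integrable
  have hIP := (((hT k).norm.pow 2).mul ((hT k).inner (hR.aebounded_meanDir hX hA k))).integrable
  have hpt : ∀ ω, ‖z (k + 1) ω - m‖ ^ 4 ≤ ‖z k ω - m‖ ^ 4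
      + 4 * g k * (‖z k ω - m‖ ^ 2 * inner ℝ (z k ω - m) (unitDir (x k ω - z k ω)))
      + (c * (g k / A) * ‖z k ω - m‖ ^ 4 + (16 / c * (g k ^ 3 * A) + 3 * g k ^ 4)) := by
    intro ω
    have hsucc := hR.norm_succ_sq (m := m) k ω
    set r := ‖z k ω - m‖ with hr
    set s := inner ℝ (z k ω - m) (unitDir (x k ω - z k ω)) with hs
    set u := ‖unitDir (x k ω - z k ω)‖ with hu
    have hu1 : u ≤ 1 := norm_unitDir_le _
    have hu0 : 0 ≤ u := norm_nonneg _
    have hr0 : 0 ≤ r := norm_nonneg _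
    have hsr : |s| ≤ r := (abs_real_inner_le_norm _ _).trans
      (mul_le_of_le_one_right (norm_nonneg _) (norm_unitDir_le _))
    have hu2 : u ^ 2 ≤ 1 := pow_le_one₀ hu0 hu1
    have hu4 : (u ^ 2) ^ 2 ≤ 1 := pow_le_one₀ (by positivity) hu2
    have hs2 : s ^ 2 ≤ r ^ 2 := by rw [← sq_abs]; gcongr
    have h1 : 4 * g k ^ 3 * u ^ 2 * s ≤ 2 * g k ^ 2 * r ^ 2 + 2 * g k ^ 4 := by
      have h2 : 4 * g k ^ 3 * u ^ 2 * s ≤ 4 * g k ^ 3 * 1 * r := by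
        refine (le_abs_self _).trans ?_
        rw [abs_mul, abs_of_nonneg (by positivity : 0 ≤ 4 * g k ^ 3 * u ^ 2)]
        gcongr
      have h3 : 0 ≤ 2 * (g k * r - g k ^ 2) ^ 2 := by positivity
      nlinarith
    -- The coefficient `8` collects `4` from `s ^ 2`, `2` from the cross term with `u ^ 2`, and `2`
    -- from `h1`. Completing the square costs one of the four units of drift, which leaves `3 * c`.
    have h4 : 8 * g k ^ 2 * r ^ 2 ≤ c * (g k / A) * r ^ 4 + 16 / c * (g k ^ 3 * A) := by
      have h5 : 0 ≤ g k / (c * A) * (c * r ^ 2 - 4 * (g k * A)) ^ 2 := by positivity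
      have h6 : g k / (c * A) * (c * r ^ 2 - 4 * (g k * A)) ^ 2 =
          c * (g k / A) * r ^ 4 + 16 / c * (g k ^ 3 * A) - 8 * g k ^ 2 * r ^ 2 := by
        field_simp
        ring
      linarith
    have h7 : g k ^ 2 * s ^ 2 ≤ g k ^ 2 * r ^ 2 := by gcongr
    have h8 : g k ^ 4 * (u ^ 2) ^ 2 ≤ g k ^ 4 := mul_le_of_le_one_right (by positivity) hu4
    have h9 : g k ^ 2 * r ^ 2 * u ^ 2 ≤ g k ^ 2 * r ^ 2 :=
      mul_le_of_le_one_right (by positivity) hu2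
    calc ‖z (k + 1) ω - m‖ ^ 4 = (r ^ 2 + 2 * g k * s + g k ^ 2 * u ^ 2) ^ 2 := by
          rw [← hsucc]; ring
      _ = r ^ 4 + 4 * g k * (r ^ 2 * s) + 4 * (g k ^ 2 * s ^ 2) + 2 * (g k ^ 2 * r ^ 2 * u ^ 2)
          + 4 * g k ^ 3 * u ^ 2 * s + g k ^ 4 * (u ^ 2) ^ 2 := by ring
      _ ≤ _ := by linarith
  -- Inside radius `A` this is the drift bound. Outside, the subtracted moment dominates `‖z k - m‖
  -- ^ 4`, so the left side is nonpositive while the right side is nonnegative.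
  have hlow : ∀ ω, c / A * (‖z k ω - m‖ ^ 4 - (A ^ (2 * N))⁻¹ * (1 + ‖z k ω - m‖ ^ 2) ^ (N + 2)) ≤
      ‖z k ω - m‖ ^ 2 * inner ℝ (z k ω - m) (meanDir μ X (z k ω)) := by
    intro ω
    have h0 := inner_dev_meanDir_nonneg hX hm (z k ω)
    have hd := hdrift A hA1 (z k ω)
    rw [real_inner_comm] at hd
    set r := ‖z k ω - m‖ with hr
    have hr0 : 0 ≤ r := norm_nonneg _
    have hcA : 0 < c / A := by positivity
    rcases le_or_gt r A with h | h
    · have h1 : c / A * r ^ 2 ≤ inner ℝ (z k ω - m) (meanDir μ X (z k ω)) := by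
        rw [div_mul_eq_mul_div, div_le_iff₀ hA0]
        linarith [hd h]
      have h2 : 0 ≤ c / A * ((A ^ (2 * N))⁻¹ * (1 + r ^ 2) ^ (N + 2)) := by positivity
      have h3 := mul_le_mul_of_nonneg_left h1 (sq_nonneg r)
      linarith
    · have h1 : r ^ 4 * A ^ (2 * N) ≤ (1 + r ^ 2) ^ (N + 2) := by
        calc r ^ 4 * A ^ (2 * N) ≤ r ^ 4 * r ^ (2 * N) := by gcongr
          _ = (r ^ 2) ^ (N + 2) := by ring
          _ ≤ _ := by gcongr; linarith
      have h2 : r ^ 4 ≤ (A ^ (2 * N))⁻¹ * (1 + r ^ 2) ^ (N + 2) := by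
        rw [inv_mul_eq_div, le_div_iff₀ (by positivity)]
        exact h1
      have h3 : c / A * (r ^ 4 - (A ^ (2 * N))⁻¹ * (1 + r ^ 2) ^ (N + 2)) ≤ 0 :=
        mul_nonpos_of_nonneg_of_nonpos hcA.le (by linarith)
      exact h3.trans (mul_nonneg (sq_nonneg r) h0)
  have hs1 : Integrable (fun ω => ‖z k ω - m‖ ^ 4 + 4 * g k *
      (‖z k ω - m‖ ^ 2 * inner ℝ (z k ω - m) (unitDir (x k ω - z k ω)))) μ :=
    (hI4 k).add (hIU.const_mul _)
  have hs2 : Integrable (fun ω => c * (g k / A) * ‖z k ω - m‖ ^ 4 +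
      (16 / c * (g k ^ 3 * A) + 3 * g k ^ 4)) μ :=
    ((hI4 k).const_mul _).add (integrable_const _)
  have hint1 := integral_mono (hI4 (k + 1)) (hs1.add hs2) hpt
  have hint2 := integral_mono (((hI4 k).sub (hIN.const_mul _)).const_mul _) hIP hlow
  have hdr := hR.integral_mul_inner_dir (m := m) hX k (f := fun r => r ^ 2) (by fun_prop)
    ((hT k).norm.pow 2)
  simp only [Pi.add_apply, Pi.sub_apply] at hint1 hint2
  rw [integral_add hs1 hs2, integral_add (hI4 k) (hIU.const_mul (4 * g k)), integral_add
      ((hI4 k).const_mul _) (integrable_const _), integral_const_mul, integral_const_mul, hdr]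
    at hint1
  rw [integral_const_mul, integral_sub (hI4 k) (hIN.const_mul _), integral_const_mul] at hint2
  simp only [integral_const, probReal_univ, one_smul] at hint1
  set a := ∫ ω, ‖z k ω - m‖ ^ 4 ∂μ
  set J := ∫ ω, ‖z k ω - m‖ ^ 2 * inner ℝ (z k ω - m) (meanDir μ X (z k ω)) ∂μ
  set W := ∫ ω, (1 + ‖z k ω - m‖ ^ 2) ^ (N + 2) ∂μ
  have h1 := mul_le_mul_of_nonneg_left hint2 (by positivity : 0 ≤ 4 * g k)
  have h2 : 4 * c * (g k / A) * (A ^ (2 * N))⁻¹ * W ≤ 4 * c * (g k / A) * (A ^ (2 * N))⁻¹ * K := by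
    gcongr
  have h3 : 4 * g k * (c / A * (a - (A ^ (2 * N))⁻¹ * W)) =
      4 * c * (g k / A) * a - 4 * c * (g k / A) * (A ^ (2 * N))⁻¹ * W := by ring
  nlinarith

end GradientRecursion

end Recursion

/-! ### Inequalities in quadratic mean. -/

section QuadraticMean

variable {Ω E : Type*} [MeasurableSpace Ω] [NormedAddCommGroup E] {μ : Measure Ω}
  [IsProbabilityMeasure μ] {Y Z : Ω → E}

lemma pow_integral_le {f : Ω → ℝ} (hf : AEBounded μ f) (hf0 : ∀ ω, 0 ≤ f ω) (p : ℕ) :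
    (∫ ω, f ω ∂μ) ^ p ≤ ∫ ω, f ω ^ p ∂μ :=
  (convexOn_pow p).map_integral_le (continuous_pow p).continuousOn isClosed_Ici
    (Eventually.of_forall hf0) hf.integrable (hf.pow p).integrable

/-- The triangle inequality in quadratic mean. -/
lemma integral_norm_add_sq_le (hY : AEBounded μ Y) (hZ : AEBounded μ Z) {a b : ℝ} (ha : 0 < a)
    (hb : 0 < b) (hYa : ∫ ω, ‖Y ω‖ ^ 2 ∂μ ≤ a ^ 2) (hZb : ∫ ω, ‖Z ω‖ ^ 2 ∂μ ≤ b ^ 2) :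
    ∫ ω, ‖Y ω + Z ω‖ ^ 2 ∂μ ≤ (a + b) ^ 2 := by
  -- Young's inequality with the weights for which the bounds `a ^ 2` and `b ^ 2` add up to exactly
  -- `(a + b) ^ 2`.
  have hpt : ∀ ω, ‖Y ω + Z ω‖ ^ 2 ≤ (1 + b / a) * ‖Y ω‖ ^ 2 + (1 + a / b) * ‖Z ω‖ ^ 2 := by
    intro ω
    have h1 := pow_le_pow_left₀ (norm_nonneg _) (norm_add_le (Y ω) (Z ω)) 2
    have h2 : 0 ≤ (b * ‖Y ω‖ - a * ‖Z ω‖) ^ 2 / (a * b) := by positivity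
    have h3 : (b * ‖Y ω‖ - a * ‖Z ω‖) ^ 2 / (a * b) =
        b / a * ‖Y ω‖ ^ 2 + a / b * ‖Z ω‖ ^ 2 - 2 * (‖Y ω‖ * ‖Z ω‖) := by
      field_simp
      ring
    nlinarith
  have hY2 := (hY.norm.pow 2).integrable
  have hZ2 := (hZ.norm.pow 2).integrable
  calc _ ≤ ∫ ω, ((1 + b / a) * ‖Y ω‖ ^ 2 + (1 + a / b) * ‖Z ω‖ ^ 2) ∂μ :=
        integral_mono ((hY.add hZ).norm.pow 2).integrable
          ((hY2.const_mul _).add (hZ2.const_mul _)) hpt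
    _ = (1 + b / a) * ∫ ω, ‖Y ω‖ ^ 2 ∂μ + (1 + a / b) * ∫ ω, ‖Z ω‖ ^ 2 ∂μ := by
        rw [integral_add (hY2.const_mul _) (hZ2.const_mul _), integral_const_mul,
          integral_const_mul]
    _ ≤ (1 + b / a) * a ^ 2 + (1 + a / b) * b ^ 2 := by gcongr
    _ = (a + b) ^ 2 := by field_simp; ring

lemma integral_norm_sq_le_of_succ {Y W : ℕ → Ω → E} (hY0 : AEBounded μ (Y 0))
    (hW : ∀ k, AEBounded μ (W k)) (hsucc : ∀ k ω, Y (k + 1) ω = Y k ω + W k ω) {b : ℝ} {w : ℕ → ℝ}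
    (hb : 0 < b) (hw : ∀ k, 0 < w k) (hYb : ∫ ω, ‖Y 0 ω‖ ^ 2 ∂μ ≤ b ^ 2)
    (hWw : ∀ k, ∫ ω, ‖W k ω‖ ^ 2 ∂μ ≤ w k ^ 2) (n : ℕ) :
    AEBounded μ (Y n) ∧ ∫ ω, ‖Y n ω‖ ^ 2 ∂μ ≤ (b + ∑ k ∈ Finset.range n, w k) ^ 2 := by
  induction n with
  | zero => simpa using ⟨hY0, hYb⟩
  | succ n ih =>
    rw [Finset.sum_range_succ, ← add_assoc, funext (hsucc n)]
    exact ⟨ih.1.add (hW n), integral_norm_add_sq_le ih.1 (hW n)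
      (add_pos_of_pos_of_nonneg hb (Finset.sum_nonneg fun k _ => (hw k).le)) (hw n) ih.2 (hWw n)⟩

/-- If `E‖M_n‖²/n → 1` then a perturbation of `M_n` of smaller order does not change this. -/
lemma tendsto_integral_norm_sub_sq_div {M R : ℕ → Ω → E}
    (hM : ∀ n, AEBounded μ (M n)) (hR : ∀ n, AEBounded μ (R n))
    (h1 : Tendsto (fun n : ℕ => (∫ ω, ‖M n ω‖ ^ 2 ∂μ) / n) atTop (nhds 1))
    (h0 : Tendsto (fun n : ℕ => (∫ ω, ‖R n ω‖ ^ 2 ∂μ) / n) atTop (nhds 0)) :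
    Tendsto (fun n : ℕ => (∫ ω, ‖M n ω - R n ω‖ ^ 2 ∂μ) / n) atTop (nhds 1) := by
  -- Young's inequality with a free parameter: as `n → ∞` only `η` survives on the right, and `η` is
  -- arbitrary.
  have hbound : ∀ η : ℝ, 0 < η → ∀ n : ℕ,
      |(∫ ω, ‖M n ω - R n ω‖ ^ 2 ∂μ) / n - (∫ ω, ‖M n ω‖ ^ 2 ∂μ) / n| ≤
        η * ((∫ ω, ‖M n ω‖ ^ 2 ∂μ) / n) + (1 + 1 / η) * ((∫ ω, ‖R n ω‖ ^ 2 ∂μ) / n) := by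
    intro η hη n
    have hM2 := ((hM n).norm.pow 2).integrable
    have hR2 := ((hR n).norm.pow 2).integrable
    have hMR2 := (((hM n).sub (hR n)).norm.pow 2).integrable
    have h2 : ∀ ω, ‖‖M n ω - R n ω‖ ^ 2 - ‖M n ω‖ ^ 2‖ ≤
        η * ‖M n ω‖ ^ 2 + (1 + 1 / η) * ‖R n ω‖ ^ 2 := by
      intro ω
      have h3 := norm_sub_le (M n ω) (R n ω)
      have h4 := norm_sub_norm_le (M n ω) (R n ω)
      have h5 : 0 ≤ (η * ‖M n ω‖ - ‖R n ω‖) ^ 2 / η := by positivity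
      have h6 : (η * ‖M n ω‖ - ‖R n ω‖) ^ 2 / η =
          η * ‖M n ω‖ ^ 2 + 1 / η * ‖R n ω‖ ^ 2 - 2 * (‖M n ω‖ * ‖R n ω‖) := by
        field_simp
        ring
      have h7 := norm_nonneg (M n ω - R n ω)
      have h8 := norm_nonneg (M n ω)
      have h9 := norm_nonneg (R n ω)
      rw [Real.norm_eq_abs, abs_le]
      constructor
      · rcases le_total ‖R n ω‖ ‖M n ω‖ with h | h
        · have := pow_le_pow_left₀ (sub_nonneg.2 h) h4 2
          nlinarith
        · nlinarith
      · have := pow_le_pow_left₀ h7 h3 2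
        nlinarith
    have h3 := norm_integral_le_of_norm_le ((hM2.const_mul η).add (hR2.const_mul (1 + 1 / η)))
      (Eventually.of_forall h2)
    rw [integral_sub hMR2 hM2] at h3
    have h4 : ∫ ω, (η * ‖M n ω‖ ^ 2 + (1 + 1 / η) * ‖R n ω‖ ^ 2) ∂μ =
        η * ∫ ω, ‖M n ω‖ ^ 2 ∂μ + (1 + 1 / η) * ∫ ω, ‖R n ω‖ ^ 2 ∂μ := by
      rw [integral_add (hM2.const_mul η) (hR2.const_mul _), integral_const_mul,
        integral_const_mul]
    have h5 : ‖(∫ ω, ‖M n ω - R n ω‖ ^ 2 ∂μ) - ∫ ω, ‖M n ω‖ ^ 2 ∂μ‖ ≤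
        η * ∫ ω, ‖M n ω‖ ^ 2 ∂μ + (1 + 1 / η) * ∫ ω, ‖R n ω‖ ^ 2 ∂μ := h3.trans_eq h4
    rw [Real.norm_eq_abs] at h5
    rw [← sub_div, abs_div, Nat.abs_cast]
    calc _ ≤ (η * ∫ ω, ‖M n ω‖ ^ 2 ∂μ + (1 + 1 / η) * ∫ ω, ‖R n ω‖ ^ 2 ∂μ) / n := by gcongr
      _ = _ := by ring
  have hdiff : Tendsto (fun n : ℕ => (∫ ω, ‖M n ω - R n ω‖ ^ 2 ∂μ) / n
      - (∫ ω, ‖M n ω‖ ^ 2 ∂μ) / n) atTop (nhds 0) := by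
    rw [Metric.tendsto_nhds]
    intro ε hε
    have hη : 0 < ε / 2 := half_pos hε
    have hlim : Tendsto (fun n : ℕ => ε / 2 * ((∫ ω, ‖M n ω‖ ^ 2 ∂μ) / n)
        + (1 + 1 / (ε / 2)) * ((∫ ω, ‖R n ω‖ ^ 2 ∂μ) / n)) atTop (nhds (ε / 2)) := by
      simpa using (h1.const_mul (ε / 2)).add (h0.const_mul (1 + 1 / (ε / 2)))
    filter_upwards [hlim.eventually (gt_mem_nhds (half_lt_self hε))] with n hn
    rw [Real.dist_eq, sub_zero]
    exact (hbound _ hη n).trans_lt hn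
  simpa using hdiff.add h1

end QuadraticMean

/-! ### Orders of magnitude of power sums. -/

section PowerSums

lemma tendsto_natCast_add_one_atTop : Tendsto (fun k : ℕ => (k : ℝ) + 1) atTop atTop :=
  tendsto_atTop_add_const_right _ _ tendsto_natCast_atTop_atTop

lemma isLittleO_rpow_rpow_atTop {s t : ℝ} (h : s < t) :
    (fun x : ℝ => x ^ s) =o[atTop] fun x : ℝ => x ^ t := by
  refine Asymptotics.isLittleO_of_tendsto' ?_ ?_
  · filter_upwards [eventually_gt_atTop 0] with x hx h0
    exact absurd h0 (Real.rpow_pos_of_pos hx t).ne'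
  · refine (tendsto_rpow_neg_atTop (sub_pos.2 h)).congr' ?_
    filter_upwards [eventually_gt_atTop 0] with x hx
    rw [neg_sub, Real.rpow_sub hx]

lemma isLittleO_natCast_add_one_rpow {s t : ℝ} (h : s < t) :
    (fun k : ℕ => ((k : ℝ) + 1) ^ s) =o[atTop] fun k : ℕ => ((k : ℝ) + 1) ^ t :=
  (isLittleO_rpow_rpow_atTop h).comp_tendsto tendsto_natCast_add_one_atTop

/-- Sums of terms of smaller order than `k^{-1/2}` are of smaller order than `n^{1/2}`. -/
lemma isLittleO_sum_range_sqrt {w : ℕ → ℝ}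
    (hw : w =o[atTop] fun k : ℕ => ((k : ℝ) + 1) ^ (-(1 / 2 : ℝ))) :
    (fun n => ∑ k ∈ Finset.range n, w k) =o[atTop] fun n : ℕ => √(n : ℝ) := by
  have hsum : ∀ n : ℕ, ∑ k ∈ Finset.range n, (√((k : ℝ) + 1) - √(k : ℝ)) = √(n : ℝ) := by
    intro n
    have := Finset.sum_range_sub (fun k : ℕ => √(k : ℝ)) n
    simpa using this
  -- The increments of the square root are comparable to `k ^ (-1/2)` and telescope, so a little-o
  -- relation between terms passes to the sums.
  have hle : (fun k : ℕ => ((k : ℝ) + 1) ^ (-(1 / 2 : ℝ))) =O[atTop]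
      fun k : ℕ => √((k : ℝ) + 1) - √(k : ℝ) := by
    refine Asymptotics.IsBigO.of_bound 2 (Eventually.of_forall fun k => ?_)
    have h1 : √(k : ℝ) ≤ √((k : ℝ) + 1) := Real.sqrt_le_sqrt (by linarith)
    rw [Real.norm_eq_abs, Real.norm_eq_abs, abs_of_pos (by positivity),
      abs_of_nonneg (sub_nonneg.2 h1), Real.rpow_neg (by positivity), ← Real.sqrt_eq_rpow]
    have h2 : 0 < √((k : ℝ) + 1) := by positivity
    have h3 : √((k : ℝ) + 1) ^ 2 = k + 1 := Real.sq_sqrt (by positivity)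
    have h4 : √(k : ℝ) ^ 2 = k := Real.sq_sqrt (by positivity)
    rw [inv_le_iff_one_le_mul₀ h2]
    nlinarith [Real.sqrt_nonneg (k : ℝ)]
  have := (hw.trans_isBigO hle).sum_range (fun k => sub_nonneg.2 (Real.sqrt_le_sqrt (by linarith)))
    (by simp only [hsum]; exact Real.tendsto_sqrt_atTop.comp tendsto_natCast_atTop_atTop)
  simpa only [hsum] using this

lemma isLittleO_sqrt_of_isLittleO_add_one {f : ℕ → ℝ}
    (hf : f =o[atTop] fun k : ℕ => ((k : ℝ) + 1) ^ (1 / 2 : ℝ)) :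
    f =o[atTop] fun n : ℕ => √(n : ℝ) := by
  refine hf.trans_isBigO (Asymptotics.IsBigO.of_bound 2 ?_)
  filter_upwards [eventually_ge_atTop 1] with n hn
  have hn' : (1 : ℝ) ≤ n := by exact_mod_cast hn
  rw [← Real.sqrt_eq_rpow, Real.norm_of_nonneg (Real.sqrt_nonneg _),
    Real.norm_of_nonneg (Real.sqrt_nonneg _), Real.sqrt_le_iff]
  refine ⟨by positivity, ?_⟩
  rw [mul_pow, Real.sq_sqrt (by positivity)]
  linarith

end PowerSums

/-! ### Fourth-moment rate and martingale decomposition. -/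

namespace GradientRecursion

variable {Ω H : Type*} [mΩ : MeasurableSpace Ω] [NormedAddCommGroup H] [InnerProductSpace ℝ H]
  [MeasurableSpace H] [BorelSpace H] [TopologicalSpace.SeparableSpace H] [CompleteSpace H]
  {μ : Measure Ω} [IsProbabilityMeasure μ] {X : Ω → H} {C : ℝ} {g : ℕ → ℝ}
  {F : ℕ → MeasurableSpace Ω} {x z : ℕ → Ω → H} {m : H}

/-- The exponent `κ` is any loss `2 * ε` away from `2 * α`, the order of `g k ^ 2`. The bound `κ >
1` serves the linearization error, and `κ > 4 * α - 2` the terms from summation by parts. -/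
lemma exists_integral_norm_pow_four_le (hR : GradientRecursion μ X g F x z) (hX : Measurable X)
    (hL : NotOnLine μ X) (hA : InvMomentBound μ X C) (hm : meanDir μ X m = 0) {c₀ α : ℝ}
    (hc₀ : 0 < c₀) (hα : 1 / 2 < α) (hα' : α < 1) (hg : ∀ k : ℕ, g k = c₀ * ((k : ℝ) + 1) ^ (-α)) :
    ∃ κ K : ℝ, 1 < κ ∧ 4 * α - 2 < κ ∧ 1 ≤ K ∧
      ∀ k : ℕ, ∫ ω, ‖z k ω - m‖ ^ 4 ∂μ ≤ K * ((k : ℝ) + 1) ^ (-κ) := by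
  obtain ⟨c, hc, hdrift⟩ := exists_le_inner_meanDir hX hL hA hm
  -- `2 * ε ≤ 1 - α` gives `β < 1` and `κ > 4 * α - 2`; `2 * ε ≤ α - 1 / 2` gives `κ > 1`. With
  -- truncation level `A = y ^ ε`, the error `g k ^ 3 * A` has exponent exactly `-(β + κ) = -(3 * α
  -- - ε)`.
  set ε := min (1 - α) (α - 1 / 2) / 2 with hε
  have hε0 : 0 < ε := by
    have : 0 < min (1 - α) (α - 1 / 2) := lt_min (by linarith) (by linarith)
    positivity
  have hε1 : 2 * ε ≤ 1 - α := by
    have := min_le_left (1 - α) (α - 1 / 2); rw [hε]; linarith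
  have hε2 : 2 * ε ≤ α - 1 / 2 := by
    have := min_le_right (1 - α) (α - 1 / 2); rw [hε]; linarith
  set κ := 2 * α - 2 * ε with hκ
  set β := α + ε with hβ
  -- The order of the moment is chosen so that the truncation error `A ^ (-2N)` is at most `y ^
  -- (-κ)`.
  obtain ⟨N, hN⟩ := exists_nat_ge (κ / (2 * ε))
  rw [div_le_iff₀ (by positivity)] at hN
  have hgpos : ∀ k, 0 < g k := fun k => by rw [hg]; positivity
  have hsq : Summable fun k => g k ^ 2 := by
    have h1 : Summable fun k : ℕ => ((k : ℝ) + 1) ^ (-(2 * α)) := by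
      have := (summable_nat_add_iff 1).2 (Real.summable_nat_rpow.2 (by linarith : -(2 * α) < -1))
      simpa using this
    refine (h1.mul_left (c₀ ^ 2)).congr fun k => ?_
    rw [hg, mul_pow, ← Real.rpow_mul_natCast (by positivity)]
    congr 2
    push_cast; ring
  obtain ⟨K, hK⟩ := hR.exists_moment_le hX hm (fun k => (hgpos k).le) hsq (N + 1)
  have hK0 : 0 ≤ K := le_trans (integral_nonneg fun ω => by positivity) (hK 0)
  obtain ⟨K', hK'0, hK'⟩ := exists_le_rpow_of_contraction (β := β) (κ := κ) (c := 3 * c * c₀)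
    (C := 4 * c * K * c₀ + 16 / c * c₀ ^ 3 + 3 * c₀ ^ 4)
    (a := fun k => ∫ ω, ‖z k ω - m‖ ^ 4 ∂μ) (by linarith) (by linarith) (by linarith)
    (by positivity) (fun k => integral_nonneg fun ω => by positivity) (fun k => by
      set y : ℝ := (k : ℝ) + 1 with hy
      have hy1 : 1 ≤ y := by rw [hy]; linarith [(Nat.cast_nonneg k : (0 : ℝ) ≤ k)]
      have hy0 : 0 < y := by positivity
      refine (hR.fourth_moment_succ_le hX hA hm hc hdrift N k (hgpos k)
        (A := y ^ ε) (Real.one_le_rpow hy1 hε0.le) (hK k)).trans ?_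
      have e1 : g k / y ^ ε = c₀ * y ^ (-β) := by
        rw [hg, mul_div_assoc, ← Real.rpow_sub hy0, hβ]; congr 2; ring
      have e2 : ((y ^ ε) ^ (2 * N))⁻¹ ≤ y ^ (-κ) := by
        rw [← Real.rpow_mul_natCast hy0.le, ← Real.rpow_neg hy0.le]
        refine Real.rpow_le_rpow_of_exponent_le hy1 ?_
        push_cast; linarith
      have e3 : g k ^ 3 * y ^ ε = c₀ ^ 3 * (y ^ (-β) * y ^ (-κ)) := by
        rw [hg, mul_pow, ← Real.rpow_mul_natCast hy0.le, mul_assoc, ← Real.rpow_add hy0,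
          ← Real.rpow_add hy0]
        congr 2
        push_cast; rw [hβ, hκ]; ring
      have e4 : g k ^ 4 ≤ c₀ ^ 4 * (y ^ (-β) * y ^ (-κ)) := by
        rw [hg, mul_pow, ← Real.rpow_mul_natCast hy0.le, ← Real.rpow_add hy0]
        refine mul_le_mul_of_nonneg_left (Real.rpow_le_rpow_of_exponent_le hy1 ?_) (by positivity)
        push_cast; linarith
      rw [e1, e3]
      have e5 : 4 * c * K * (c₀ * y ^ (-β)) * ((y ^ ε) ^ (2 * N))⁻¹ ≤
          4 * c * K * (c₀ * y ^ (-β)) * y ^ (-κ) := by gcongr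
      refine add_le_add (le_of_eq (by ring)) ?_
      linarith)
  refine ⟨κ, K' + 1, by linarith, by linarith, by linarith, fun k => (hK' k).trans ?_⟩
  gcongr
  linarith

/-- The martingale part of the averaged recursion. -/
noncomputable def noise (μ : Measure Ω) (X : Ω → H) (x z : ℕ → Ω → H) (n : ℕ) (ω : Ω) : H :=
  ∑ k ∈ Finset.range n, (unitDir (x k ω - z k ω) + meanDir μ X (z k ω))

lemma aebounded_noise (hR : GradientRecursion μ X g F x z) (hX : Measurable X)
    (hA : InvMomentBound μ X C) (n : ℕ) : AEBounded μ (noise μ X x z n) :=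
  AEBounded.sum _ fun k _ => (hR.aebounded_dir k).add (hR.aebounded_meanDir hX hA k)

lemma measurable_noise (hR : GradientRecursion μ X g F x z) (hX : Measurable X)
    (hA : InvMomentBound μ X C) (n : ℕ) : Measurable[F n] (noise μ X x z n) := by
  unfold noise
  refine Finset.measurable_sum _ fun k hk => ?_
  have hk' : k + 1 ≤ n := Finset.mem_range.1 hk
  have hz : Measurable[F n] (z k) :=
    (hR.measurable_z k).mono (hR.mono (Nat.le_of_succ_le hk')) le_rfl
  have hx : Measurable[F n] (x k) := (hR.measurable_x k).mono (hR.mono hk') le_rfl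
  exact (measurable_unitDir.comp (hx.sub hz)).add ((continuous_meanDir hX hA).measurable.comp hz)

lemma ae_norm_dir (hR : GradientRecursion μ X g F x z) (hX : Measurable X)
    (hA : InvMomentBound μ X C) (k : ℕ) : ∀ᵐ ω ∂μ, ‖unitDir (x k ω - z k ω)‖ = 1 := by
  filter_upwards [ae_ne_of_indep hX hA (hR.measurable_x' k) (hR.le k) (hR.law k) (hR.indep k)
    (hR.measurable_z k)] with ω hω using norm_unitDir (sub_ne_zero.2 hω)

/-- Martingale increments are orthogonal, and an almost surely unit vector with conditional mean
`-Φ` has conditional variance `1 - ‖Φ‖²`. -/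
lemma integral_norm_noise_sq (hR : GradientRecursion μ X g F x z) (hX : Measurable X)
    (hA : InvMomentBound μ X C) (n : ℕ) :
    ∫ ω, ‖noise μ X x z n ω‖ ^ 2 ∂μ =
      n - ∑ k ∈ Finset.range n, ∫ ω, ‖meanDir μ X (z k ω)‖ ^ 2 ∂μ := by
  induction n with
  | zero => simp [noise]
  | succ n ih =>
    have hM := hR.aebounded_noise hX hA n
    have hU := hR.aebounded_dir n
    have hP := hR.aebounded_meanDir hX hA n
    have hPm : Measurable[F n] fun ω => meanDir μ X (z n ω) :=
      (continuous_meanDir hX hA).measurable.comp (hR.measurable_z n)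
    have e1 := hR.integral_inner_dir hX n (hR.measurable_noise hX hA n) hM
    have e2 := hR.integral_inner_dir hX n hPm hP
    simp only [real_inner_self_eq_norm_sq] at e2
    have e3 : ∫ ω, ‖unitDir (x n ω - z n ω)‖ ^ 2 ∂μ = 1 := by
      rw [integral_congr_ae (g := fun _ => (1 : ℝ))
        ((hR.ae_norm_dir hX hA n).mono fun ω hω => by simp [hω])]
      simp
    have hpt : ∀ ω, ‖noise μ X x z (n + 1) ω‖ ^ 2 =
        (‖noise μ X x z n ω‖ ^ 2 + ‖unitDir (x n ω - z n ω)‖ ^ 2 + ‖meanDir μ X (z n ω)‖ ^ 2)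
        + 2 * (inner ℝ (noise μ X x z n ω) (unitDir (x n ω - z n ω))
          + inner ℝ (noise μ X x z n ω) (meanDir μ X (z n ω))
          + inner ℝ (meanDir μ X (z n ω)) (unitDir (x n ω - z n ω))) := by
      intro ω
      rw [noise, Finset.sum_range_succ, norm_add_sq_real, norm_add_sq_real, inner_add_right,
        ← noise, real_inner_comm (unitDir (x n ω - z n ω)) (meanDir μ X (z n ω))]
      ring
    have i1 := (hM.norm.pow 2).integrable
    have i2 := (hU.norm.pow 2).integrable
    have i3 := (hP.norm.pow 2).integrable
    have i4 := (hM.inner hU).integrable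
    have i5 := (hM.inner hP).integrable
    have i6 := (hP.inner hU).integrable
    have i12 := (((hM.norm.pow 2).add (hU.norm.pow 2))).integrable
    have i123 := (((hM.norm.pow 2).add (hU.norm.pow 2)).add (hP.norm.pow 2)).integrable
    have i45 := ((hM.inner hU).add (hM.inner hP)).integrable
    have i456 := (((hM.inner hU).add (hM.inner hP)).add (hP.inner hU)).integrable
    rw [integral_congr_ae (Eventually.of_forall hpt), integral_add i123 (i456.const_mul 2),
      integral_const_mul, integral_add i12 i3, integral_add i1 i2, integral_add i45 i6,
      integral_add i4 i5, e1, e2, e3, ih, Finset.sum_range_succ]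
    push_cast
    ring

/-- Each direction is the increment of the deviation divided by the step. Summation by parts moves
the differences onto the inverse steps and leaves two boundary terms. -/
lemma sum_clm_dev_eq (hR : GradientRecursion μ X g F x z) (hg : ∀ k, g k ≠ 0) (L : H →L[ℝ] H)
    (n : ℕ) (ω : Ω) :
    L (∑ k ∈ Finset.range n, (z k ω - m)) = noise μ X x z n ω
      - ((-(g 0)⁻¹ • (z 0 ω - m) + ∑ k ∈ Finset.range n,
          ((meanDir μ X (z k ω) - L (z k ω - m))
            + ((g k)⁻¹ - (g (k + 1))⁻¹) • (z (k + 1) ω - m)))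
        + (g n)⁻¹ • (z n ω - m)) := by
  induction n with
  | zero => simp [noise]
  | succ n ih =>
    have h1 : (g n)⁻¹ • (z (n + 1) ω - m) = (g n)⁻¹ • (z n ω - m) + unitDir (x n ω - z n ω) := by
      rw [hR.succ, add_sub_right_comm, smul_add, smul_smul, inv_mul_cancel₀ (hg n), one_smul]
    rw [Finset.sum_range_succ, map_add, ih, noise, noise, Finset.sum_range_succ,
      Finset.sum_range_succ, sub_smul, h1]
    abel

end GradientRecursion

lemma rpow_add_one_sub_rpow_le {α x : ℝ} (hα : 0 ≤ α) (hα' : α ≤ 1) (hx : 0 < x) :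
    (x + 1) ^ α - x ^ α ≤ x ^ (α - 1) := by
  have h1 : (1 + x⁻¹) ^ α ≤ 1 + α * x⁻¹ :=
    rpow_one_add_le_one_add_mul_self (by linarith [inv_pos.2 hx]) hα hα'
  have h2 : x + 1 = x * (1 + x⁻¹) := by field_simp
  rw [h2, Real.mul_rpow hx.le (by positivity), Real.rpow_sub_one hx.ne', div_eq_mul_inv]
  have h3 := mul_le_mul_of_nonneg_left h1 (Real.rpow_nonneg hx.le α)
  have h4 : α * (x ^ α * x⁻¹) ≤ 1 * (x ^ α * x⁻¹) := by gcongr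
  linarith

/-! ### Negligible remainder, asymptotics and nondegeneracy. -/

namespace GradientRecursion

variable {Ω H : Type*} [mΩ : MeasurableSpace Ω] [NormedAddCommGroup H] [InnerProductSpace ℝ H]
  [MeasurableSpace H] [BorelSpace H] [TopologicalSpace.SeparableSpace H] [CompleteSpace H]
  {μ : Measure Ω} [IsProbabilityMeasure μ] {X : Ω → H} {C : ℝ} {g : ℕ → ℝ}
  {F : ℕ → MeasurableSpace Ω} {x z : ℕ → Ω → H} {m : H}

/-- Jensen's inequality; `1 ≤ K` gives `K ≤ K ^ 4`, which avoids roots of the constant. -/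
lemma integral_norm_sq_le_of_pow_four (hR : GradientRecursion μ X g F x z) {K κ : ℝ} (hK : 1 ≤ K)
    (k : ℕ) (h : ∫ ω, ‖z k ω - m‖ ^ 4 ∂μ ≤ K * ((k : ℝ) + 1) ^ (-κ)) :
    ∫ ω, ‖z k ω - m‖ ^ 2 ∂μ ≤ (K * ((k : ℝ) + 1) ^ (-(κ / 4))) ^ 2 := by
  have hy : 0 < (k : ℝ) + 1 := by positivity
  have h1 := pow_integral_le ((hR.aebounded_dev (m := m) k).norm.pow 2) (fun ω => by positivity) 2
  simp only [← pow_mul] at h1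
  refine le_of_sq_le_sq ?_ (by positivity)
  refine (h1.trans h).trans ?_
  rw [← pow_mul, mul_pow, ← Real.rpow_mul_natCast hy.le]
  have h2 : K ≤ K ^ (2 * 2) := le_self_pow₀ hK (by norm_num)
  have h3 : -(κ / 4) * ((2 * 2 : ℕ) : ℝ) = -κ := by push_cast; ring
  rw [h3]
  gcongr

/-- The remainder of the averaged recursion after linearization and summation by parts. -/
noncomputable def remainder (μ : Measure Ω) (X : Ω → H) (g : ℕ → ℝ) (z : ℕ → Ω → H) (m : H)
    (n : ℕ) (ω : Ω) : H :=
  (-(g 0)⁻¹ • (z 0 ω - m) + ∑ k ∈ Finset.range n,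
    ((meanDir μ X (z k ω) - meanDeriv μ X m (z k ω - m))
      + ((g k)⁻¹ - (g (k + 1))⁻¹) • (z (k + 1) ω - m))) + (g n)⁻¹ • (z n ω - m)

lemma integral_norm_smul_sq_le (a : ℝ) {Y : Ω → H} {A b : ℝ} (ha : |a| ≤ A)
    (h : ∫ ω, ‖Y ω‖ ^ 2 ∂μ ≤ b ^ 2) : ∫ ω, ‖a • Y ω‖ ^ 2 ∂μ ≤ (A * b) ^ 2 := by
  simp only [norm_smul, mul_pow, integral_const_mul, Real.norm_eq_abs]
  gcongr

/-- The triangle inequality in quadratic mean suffices: linearization errors have size `k ^ (-κ /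
2)`, summation-by-parts terms `k ^ (α - 1 - κ / 4)`, and the last boundary term `n ^ (α - κ / 4)`.
-/
lemma tendsto_integral_norm_remainder_sq_div (hR : GradientRecursion μ X g F x z)
    (hX : Measurable X) (hL : NotOnLine μ X) (hA : InvMomentBound μ X C)
    (hm : meanDir μ X m = 0) {c₀ α : ℝ} (hc₀ : 0 < c₀) (hα : 1 / 2 < α) (hα' : α < 1)
    (hg : ∀ k : ℕ, g k = c₀ * ((k : ℝ) + 1) ^ (-α)) :
    (∀ n, AEBounded μ (remainder μ X g z m n)) ∧
    Tendsto (fun n : ℕ => (∫ ω, ‖remainder μ X g z m n ω‖ ^ 2 ∂μ) / n) atTop (nhds 0) := by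
  obtain ⟨κ, K, hκ1, hκ2, hK1, hK⟩ :=
    hR.exists_integral_norm_pow_four_le hX hL hA hm hc₀ hα hα' hg
  have hC := hA.pos
  have hK0 : 0 < K := by linarith
  have hT := fun k => hR.aebounded_dev (m := m) k
  have hP := fun k => hR.aebounded_meanDir hX hA k
  have hsq := fun k => hR.integral_norm_sq_le_of_pow_four (m := m) hK1 k (hK k)
  have hginv : ∀ k, (g k)⁻¹ = c₀⁻¹ * ((k : ℝ) + 1) ^ α := fun k => by
    rw [hg, mul_inv, Real.rpow_neg (by positivity), inv_inv]
  have hlin : ∀ k, ∫ ω, ‖meanDir μ X (z k ω) - meanDeriv μ X m (z k ω - m)‖ ^ 2 ∂μ ≤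
      (4 * C * K * ((k : ℝ) + 1) ^ (-(κ / 2))) ^ 2 := by
    intro k
    have hy : 0 < (k : ℝ) + 1 := by positivity
    calc _ ≤ ∫ ω, (4 * C) ^ 2 * ‖z k ω - m‖ ^ 4 ∂μ := by
          refine integral_mono (((hP k).sub ((hT k).clm _)).norm.pow 2).integrable
            (((hT k).norm.pow 4).integrable.const_mul _) fun ω => ?_
          have := norm_meanDir_sub_sub_le hX hA m (z k ω)
          rw [hm, sub_zero] at this
          refine (pow_le_pow_left₀ (norm_nonneg _) this 2).trans_eq (by ring)
      _ ≤ (4 * C) ^ 2 * (K ^ 2 * ((k : ℝ) + 1) ^ (-κ)) := by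
          rw [integral_const_mul]
          have h2 : K ≤ K ^ 2 := le_self_pow₀ hK1 (by norm_num)
          have h3 : K * ((k : ℝ) + 1) ^ (-κ) ≤ K ^ 2 * ((k : ℝ) + 1) ^ (-κ) := by gcongr
          exact mul_le_mul_of_nonneg_left ((hK k).trans h3) (by positivity)
      _ = _ := by
          have h3 : -(κ / 2) * ((2 : ℕ) : ℝ) = -κ := by push_cast; ring
          rw [mul_pow (4 * C * K), ← Real.rpow_mul_natCast hy.le, h3]; ring
  have habel : ∀ k, ∫ ω, ‖((g k)⁻¹ - (g (k + 1))⁻¹) • (z (k + 1) ω - m)‖ ^ 2 ∂μ ≤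
      (c₀⁻¹ * K * ((k : ℝ) + 1) ^ (α - 1 - κ / 4)) ^ 2 := by
    intro k
    have hy : 0 < (k : ℝ) + 1 := by positivity
    have h1 : |(g k)⁻¹ - (g (k + 1))⁻¹| ≤ c₀⁻¹ * ((k : ℝ) + 1) ^ (α - 1) := by
      rw [hginv, hginv, abs_sub_comm, ← mul_sub, abs_mul, abs_of_pos (inv_pos.2 hc₀)]
      push_cast
      have h2 : ((k : ℝ) + 1) ^ α ≤ ((k : ℝ) + 1 + 1) ^ α :=
        Real.rpow_le_rpow hy.le (by linarith) (by linarith)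
      rw [abs_of_nonneg (sub_nonneg.2 h2)]
      gcongr
      exact rpow_add_one_sub_rpow_le (by linarith) hα'.le hy
    have h2 : ∫ ω, ‖z (k + 1) ω - m‖ ^ 2 ∂μ ≤ (K * ((k : ℝ) + 1) ^ (-(κ / 4))) ^ 2 := by
      refine (hsq (k + 1)).trans ?_
      have : (((k + 1 : ℕ) : ℝ) + 1) ^ (-(κ / 4)) ≤ ((k : ℝ) + 1) ^ (-(κ / 4)) :=
        Real.rpow_le_rpow_of_nonpos hy (by push_cast; linarith) (by linarith)
      gcongr
    refine (integral_norm_smul_sq_le _ h1 h2).trans_eq ?_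
    rw [show α - 1 - κ / 4 = (α - 1) + -(κ / 4) by ring, Real.rpow_add hy]
    ring
  have hlast : ∀ k, ∫ ω, ‖(g k)⁻¹ • (z k ω - m)‖ ^ 2 ∂μ ≤
      (c₀⁻¹ * K * ((k : ℝ) + 1) ^ (α - κ / 4)) ^ 2 := by
    intro k
    have hy : 0 < (k : ℝ) + 1 := by positivity
    have h1 : |(g k)⁻¹| ≤ c₀⁻¹ * ((k : ℝ) + 1) ^ α := by
      rw [hginv, abs_of_pos (by positivity)]
    refine (integral_norm_smul_sq_le _ h1 (hsq k)).trans_eq ?_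
    rw [show α - κ / 4 = α + -(κ / 4) by ring, Real.rpow_add hy]
    ring
  set w : ℕ → ℝ := fun k => 4 * C * K * ((k : ℝ) + 1) ^ (-(κ / 2))
    + c₀⁻¹ * K * ((k : ℝ) + 1) ^ (α - 1 - κ / 4) with hw
  set b : ℝ := c₀⁻¹ * K with hb
  have hlinB := fun k => (hP k).sub ((hT k).clm (meanDeriv μ X m))
  have habelB := fun k => (hT (k + 1)).const_smul ((g k)⁻¹ - (g (k + 1))⁻¹)
  have hmain := integral_norm_sq_le_of_succ (μ := μ)
    (Y := fun n ω => -(g 0)⁻¹ • (z 0 ω - m) + ∑ k ∈ Finset.range n,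
      ((meanDir μ X (z k ω) - meanDeriv μ X m (z k ω - m))
        + ((g k)⁻¹ - (g (k + 1))⁻¹) • (z (k + 1) ω - m)))
    (W := fun k ω => (meanDir μ X (z k ω) - meanDeriv μ X m (z k ω - m))
        + ((g k)⁻¹ - (g (k + 1))⁻¹) • (z (k + 1) ω - m)) (b := b) (w := w)
    (by simpa using (hT 0).const_smul (-(g 0)⁻¹))
    (fun k => (hlinB k).add (habelB k))
    (fun k ω => by simp only [Finset.sum_range_succ, add_assoc])
    (by positivity) (fun k => by positivity)
    (by simpa [norm_neg, hb] using hlast 0)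
    (fun k => integral_norm_add_sq_le (hlinB k) (habelB k) (by positivity) (by positivity)
      (hlin k) (habel k))
  have hlastB := fun k => (hT k).const_smul (g k)⁻¹
  have hremB : ∀ n, AEBounded μ (remainder μ X g z m n) := fun n => (hmain n).1.add (hlastB n)
  refine ⟨hremB, ?_⟩
  set s : ℕ → ℝ := fun n => b + ∑ k ∈ Finset.range n, w k
    + c₀⁻¹ * K * ((n : ℝ) + 1) ^ (α - κ / 4) with hs
  have hrem : ∀ n, ∫ ω, ‖remainder μ X g z m n ω‖ ^ 2 ∂μ ≤ s n ^ 2 := fun n =>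
    integral_norm_add_sq_le (hmain n).1 (hlastB n)
      (add_pos_of_pos_of_nonneg (by positivity) (Finset.sum_nonneg fun k _ => by positivity))
      (by positivity) (hmain n).2 (hlast n)
  -- The three comparisons are `-κ / 2 < -1 / 2`, from `κ > 1`, and `α - 1 - κ / 4 < -1 / 2` and `α
  -- - κ / 4 < 1 / 2`, from `κ > 4 * α - 2`.
  have hso : s =o[atTop] fun n : ℕ => √(n : ℝ) := by
    refine Asymptotics.IsLittleO.add (Asymptotics.IsLittleO.add ?_ ?_) ?_
    · refine (Asymptotics.isLittleO_const_left.2 (Or.inr ?_))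
      refine tendsto_norm_atTop_atTop.comp ?_
      exact Real.tendsto_sqrt_atTop.comp tendsto_natCast_atTop_atTop
    · refine isLittleO_sum_range_sqrt (Asymptotics.IsLittleO.add ?_ ?_)
      · exact (isLittleO_natCast_add_one_rpow (by linarith)).const_mul_left _
      · exact (isLittleO_natCast_add_one_rpow (by linarith)).const_mul_left _
    · refine isLittleO_sqrt_of_isLittleO_add_one ?_
      exact (isLittleO_natCast_add_one_rpow (by linarith)).const_mul_left _
  have hlim : Tendsto (fun n : ℕ => (s n / √(n : ℝ)) ^ 2) atTop (nhds 0) := by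
    simpa using hso.tendsto_div_nhds_zero.pow 2
  refine squeeze_zero (fun n => by positivity) (fun n => ?_) hlim
  rw [div_pow, Real.sq_sqrt (Nat.cast_nonneg n)]
  exact div_le_div_of_nonneg_right (hrem n) (Nat.cast_nonneg n)

/-- The gradient tends to zero in quadratic mean along the iterates, so by Cesàro the noise has
second moment equivalent to `n`; the remainder does not change this. -/
lemma tendsto_integral_norm_meanDeriv_sum_sq_div (hR : GradientRecursion μ X g F x z)
    (hX : Measurable X) (hL : NotOnLine μ X) (hA : InvMomentBound μ X C)
    (hm : meanDir μ X m = 0) {c₀ α : ℝ} (hc₀ : 0 < c₀) (hα : 1 / 2 < α) (hα' : α < 1)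
    (hg : ∀ k : ℕ, g k = c₀ * ((k : ℝ) + 1) ^ (-α)) :
    Tendsto (fun n : ℕ =>
      (∫ ω, ‖meanDeriv μ X m (∑ k ∈ Finset.range n, (z k ω - m))‖ ^ 2 ∂μ) / n) atTop (nhds 1) := by
  obtain ⟨hB, h0⟩ :=
    hR.tendsto_integral_norm_remainder_sq_div hX hL hA hm hc₀ hα hα' hg
  obtain ⟨κ, K, hκ1, hκ2, hK1, hK⟩ :=
    hR.exists_integral_norm_pow_four_le hX hL hA hm hc₀ hα hα' hg
  have hg0 : ∀ k, g k ≠ 0 := fun k => by rw [hg]; positivity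
  have hgrad : Tendsto (fun k => ∫ ω, ‖meanDir μ X (z k ω)‖ ^ 2 ∂μ) atTop (nhds 0) := by
    have hlim : Tendsto (fun k : ℕ => (2 * C) ^ 2 * (K * ((k : ℝ) + 1) ^ (-(κ / 4))) ^ 2) atTop
        (nhds 0) := by
      have := (((tendsto_rpow_neg_atTop (by linarith : 0 < κ / 4)).comp
        tendsto_natCast_add_one_atTop).const_mul K).pow 2 |>.const_mul ((2 * C) ^ 2)
      simpa using this
    refine squeeze_zero (fun k => integral_nonneg fun ω => by positivity) (fun k => ?_) hlim
    have hT := hR.aebounded_dev (m := m) k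
    calc _ ≤ ∫ ω, (2 * C) ^ 2 * ‖z k ω - m‖ ^ 2 ∂μ := by
          refine integral_mono ((hR.aebounded_meanDir hX hA k).norm.pow 2).integrable
            ((hT.norm.pow 2).integrable.const_mul _) fun ω => ?_
          have := norm_meanDir_sub_le hX hA m (z k ω)
          rw [hm, sub_zero] at this
          exact (pow_le_pow_left₀ (norm_nonneg _) this 2).trans_eq (by ring)
      _ ≤ _ := by
          rw [integral_const_mul]
          gcongr
          exact hR.integral_norm_sq_le_of_pow_four hK1 k (hK k)
  have h1 : Tendsto (fun n : ℕ => (∫ ω, ‖noise μ X x z n ω‖ ^ 2 ∂μ) / n) atTop (nhds 1) := by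
    have hces := hgrad.cesaro.const_sub 1
    rw [sub_zero] at hces
    refine hces.congr' ?_
    filter_upwards [eventually_gt_atTop 0] with n hn
    have hn' : (n : ℝ) ≠ 0 := by positivity
    rw [hR.integral_norm_noise_sq hX hA]
    field_simp
  refine (tendsto_integral_norm_sub_sq_div (hR.aebounded_noise hX hA) hB h1 h0).congr fun n => ?_
  simp only [hR.sum_clm_dev_eq hg0 (meanDeriv μ X m) n, remainder]

/-- If the sum vanished almost surely, its past part `B` would equal `-g n` times the last
direction, so their pairing would have mean `-g n`. Freezing the past gives instead minus the mean
of `⟪B, Φ(z n)⟫`, which is almost surely `< g n` because `‖Φ‖ < 1`. -/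
lemma integral_norm_sum_sq_pos (hR : GradientRecursion μ X g F x z) (hX : Measurable X)
    (hL : NotOnLine μ X) (hA : InvMomentBound μ X C) (n : ℕ) (hg : 0 < g n) :
    0 < ∫ ω, ‖∑ k ∈ Finset.range (n + 2), (z k ω - m)‖ ^ 2 ∂μ := by
  set B : Ω → H := fun ω => ∑ k ∈ Finset.range (n + 1), (z k ω - m) + (z n ω - m) with hB
  have hBm : Measurable[F n] B := by
    refine Measurable.add (Finset.measurable_sum _ fun k hk => ?_)
      ((hR.measurable_z n).sub_const m)
    exact ((hR.measurable_z k).mono (hR.mono (Nat.lt_succ_iff.1 (Finset.mem_range.1 hk)))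
      le_rfl).sub_const m
  have hBb : AEBounded μ B :=
    (AEBounded.sum _ fun k _ => hR.aebounded_dev k).add (hR.aebounded_dev n)
  have hP := hR.aebounded_meanDir hX hA n
  have hsum : ∀ ω, ∑ k ∈ Finset.range (n + 2), (z k ω - m) =
      B ω + g n • unitDir (x n ω - z n ω) := by
    intro ω
    rw [Finset.sum_range_succ, hR.succ, add_sub_right_comm, ← add_assoc]
  have hi : Integrable (fun ω => ‖∑ k ∈ Finset.range (n + 2), (z k ω - m)‖ ^ 2) μ :=
    ((AEBounded.sum _ fun k _ => hR.aebounded_dev k).norm.pow 2).integrable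
  refine lt_of_le_of_ne (integral_nonneg fun ω => by positivity) fun h0 => ?_
  have hae := (integral_eq_zero_iff_of_nonneg (fun ω => by positivity) hi).1 h0.symm
  have hBU : ∀ᵐ ω ∂μ, B ω = -(g n • unitDir (x n ω - z n ω)) := by
    filter_upwards [hae] with ω hω
    have : ‖∑ k ∈ Finset.range (n + 2), (z k ω - m)‖ ^ 2 = 0 := hω
    rw [hsum, sq_eq_zero_iff, norm_eq_zero] at this
    exact eq_neg_of_add_eq_zero_left this
  have hnorm := hR.ae_norm_dir hX hA n
  have e1 : ∫ ω, inner ℝ (B ω) (unitDir (x n ω - z n ω)) ∂μ = -g n := by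
    rw [integral_congr_ae (g := fun _ => -g n)]
    · simp
    · filter_upwards [hBU, hnorm] with ω h1 h2
      rw [h1, inner_neg_left, real_inner_smul_left, real_inner_self_eq_norm_sq, h2]
      ring
  have e2 := hR.integral_inner_dir hX n hBm hBb
  have e3 : ∫ ω, (g n - inner ℝ (B ω) (meanDir μ X (z n ω))) ∂μ = 0 := by
    rw [integral_sub (integrable_const _) (hBb.inner hP).integrable]
    simp only [integral_const, probReal_univ, one_smul]
    linarith
  have hpos : ∀ᵐ ω ∂μ, 0 < g n - inner ℝ (B ω) (meanDir μ X (z n ω)) := by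
    filter_upwards [hBU, hnorm] with ω h1 h2
    have h3 := real_inner_le_norm (B ω) (meanDir μ X (z n ω))
    have h4 : ‖B ω‖ = g n := by
      rw [h1, norm_neg, norm_smul, h2, mul_one, Real.norm_eq_abs, abs_of_pos hg]
    have h5 := mul_lt_mul_of_pos_left (norm_meanDir_lt_one hX hL hA (z n ω)) hg
    rw [h4] at h3
    linarith
  have h6 := (integral_eq_zero_iff_of_nonneg_ae (hpos.mono fun ω h => h.le)
    (((AEBounded.const (g n)).sub (hBb.inner hP)).integrable)).1 e3
  obtain ⟨ω, h7, h8⟩ := (h6.and hpos).exists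
  exact h8.ne' h7

end GradientRecursion

/-! ### Regrouping independent variables. -/

section Independence

variable {Ω α β γ : Type*} [MeasurableSpace Ω] [MeasurableSpace α] [MeasurableSpace β]
  [MeasurableSpace γ] {μ : Measure Ω} [IsProbabilityMeasure μ]

/-- The two hypotheses factor the joint law completely, and products of measures are associative. It
adjoins the initial value to the past samples. -/
lemma IndepFun.prodMk_left_of_prodMk_right {A : Ω → α} {P : Ω → β} {Q : Ω → γ} (hA : Measurable A)
    (hP : Measurable P) (hQ : Measurable Q) (h1 : IndepFun A (fun ω => (P ω, Q ω)) μ)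
    (h2 : IndepFun P Q μ) : IndepFun (fun ω => (A ω, P ω)) Q μ := by
  have h3 : IndepFun A P μ := h1.comp measurable_id measurable_fst
  have := Measure.isProbabilityMeasure_map hA.aemeasurable (μ := μ)
  have := Measure.isProbabilityMeasure_map hP.aemeasurable (μ := μ)
  have := Measure.isProbabilityMeasure_map hQ.aemeasurable (μ := μ)
  rw [indepFun_iff_map_prod_eq_prod_map_map (by fun_prop) (by fun_prop)] at h1 h2 h3 ⊢
  refine MeasurableEquiv.prodAssoc.map_measurableEquiv_injective ?_
  rw [h3, Measure.prodAssoc_prod, ← h2, ← h1,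
    Measure.map_map (MeasurableEquiv.measurable _) (by fun_prop)]
  rfl

end Independence

/-- Only finitely many indices escape the eventual bound, so a minimum works; `S` leaves room for
the exempt case `n = 1`. -/
lemma exists_pos_le_of_eventually {s : ℕ → ℝ} {S : ℕ → Prop} {c : ℝ} (hc : 0 < c)
    (hpos : ∀ n, S n → 0 < s n) (hev : ∀ᶠ n in atTop, c ≤ s n) :
    ∃ d, 0 < d ∧ ∀ n, S n → d ≤ s n := by
  obtain ⟨N, hN⟩ := eventually_atTop.1 hev
  have key : ∀ M, ∃ d, 0 < d ∧ ∀ n < M, S n → d ≤ s n := by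
    intro M
    induction M with
    | zero => exact ⟨1, one_pos, fun n hn => absurd hn (Nat.not_lt_zero n)⟩
    | succ M ih =>
      obtain ⟨d, hd, h⟩ := ih
      by_cases hS : S M
      · refine ⟨min d (s M), lt_min hd (hpos M hS), fun n hn hSn => ?_⟩
        rcases Nat.lt_succ_iff_lt_or_eq.1 hn with hlt | rfl
        · exact (min_le_left _ _).trans (h n hlt hSn)
        · exact min_le_right _ _
      · refine ⟨d, hd, fun n hn hSn => ?_⟩
        rcases Nat.lt_succ_iff_lt_or_eq.1 hn with hlt | rfl
        · exact h n hlt hSn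
        · exact absurd hSn hS
  obtain ⟨d, hd, h⟩ := key N
  refine ⟨min d c, lt_min hd hc, fun n hS => ?_⟩
  rcases lt_or_ge n N with hn | hn
  · exact (min_le_left _ _).trans (h n hn hS)
  · exact (min_le_right _ _).trans (hN n hn)

/-! ### The algorithm as an instance of the recursion. -/

section Algorithm

variable {Ω H : Type*} [mΩ : MeasurableSpace Ω] [NormedAddCommGroup H] [InnerProductSpace ℝ H]

/-- The information in `Z₁, X₂, …, X_{k+1}`. -/
abbrev past [MeasurableSpace H] (Xs : ℕ → Ω → H) (Z₁ : Ω → H) (k : ℕ) : MeasurableSpace Ω :=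
  MeasurableSpace.comap (fun ω => (Z₁ ω, fun i : Finset.range k => Xs (i + 2) ω)) inferInstance

lemma measurable_past_init [MeasurableSpace H] (Xs : ℕ → Ω → H) (Z₁ : Ω → H) (k : ℕ) :
    Measurable[past Xs Z₁ k] Z₁ :=
  measurable_fst.comp
    (comap_measurable (fun ω => (Z₁ ω, fun i : Finset.range k => Xs (i + 2) ω)))

lemma measurable_past_of_lt [MeasurableSpace H] (Xs : ℕ → Ω → H) (Z₁ : Ω → H) {i k : ℕ}
    (h : i < k) : Measurable[past Xs Z₁ k] (Xs (i + 2)) :=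
  ((measurable_pi_apply (⟨i, Finset.mem_range.2 h⟩ : Finset.range k)).comp measurable_snd).comp
    (comap_measurable (fun ω => (Z₁ ω, fun i : Finset.range k => Xs (i + 2) ω)))

lemma past_le_of_measurable [MeasurableSpace H] {Xs : ℕ → Ω → H} {Z₁ : Ω → H} {k : ℕ}
    {m' : MeasurableSpace Ω} (hZ : Measurable[m'] Z₁)
    (hX : ∀ i < k, Measurable[m'] (Xs (i + 2))) : past Xs Z₁ k ≤ m' := by
  refine Measurable.comap_le (hZ.prodMk (measurable_pi_lambda _ fun i => ?_))
  exact hX i (Finset.mem_range.1 i.2)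

variable [MeasurableSpace H] [BorelSpace H] [TopologicalSpace.SeparableSpace H] [CompleteSpace H]
  {μ : Measure Ω} [IsProbabilityMeasure μ]

/-- Indices are shifted to start at zero: `z k`, `x k`, `g k` stand for `Z_{k+1}`, `X_{k+2}`,
`γ_{k+1}`. -/
lemma gradientRecursion_robbinsMonro {X : Ω → H} {Xs : ℕ → Ω → H}
    (hXs : ∀ n, 1 ≤ n → Measurable (Xs n)) (hlaw : ∀ n, 1 ≤ n → IdentDistrib (Xs n) X μ μ)
    (hindep : iIndepFun (fun n : ℕ => Xs (n + 1)) μ) {Z₁ : Ω → H} (hZ₁ : Measurable Z₁)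
    (hbdd : ∃ M : ℝ, ∀ᵐ ω ∂μ, ‖Z₁ ω‖ ≤ M)
    (hZ₁indep : IndepFun Z₁ (fun ω (n : ℕ) => Xs (n + 2) ω) μ) (γ : ℕ → ℝ) :
    GradientRecursion μ X (fun k => γ (k + 1)) (past Xs Z₁) (fun k => Xs (k + 2))
      (fun k => robbinsMonro γ Xs Z₁ (k + 1)) where
  le k := past_le_of_measurable hZ₁ fun i _ => hXs _ (by omega)
  mono k l hkl := past_le_of_measurable (measurable_past_init Xs Z₁ l)
    fun i hi => measurable_past_of_lt Xs Z₁ (hi.trans_le hkl)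
  measurable_z k := by
    -- The induction needs all later times `l`: an iterate must also be measurable once the next
    -- sample has been added.
    suffices h : ∀ l, k ≤ l → Measurable[past Xs Z₁ l] (robbinsMonro γ Xs Z₁ (k + 1)) from
      h k le_rfl
    induction k with
    | zero => exact fun l _ => measurable_past_init Xs Z₁ l
    | succ k ih =>
      intro l hl
      have h1 := ih l (by omega)
      have h2 := measurable_past_of_lt Xs Z₁ (show k < l by omega)
      exact h1.add ((measurable_unitDir.comp (h2.sub h1)).const_smul _)
  measurable_x k := measurable_past_of_lt Xs Z₁ (Nat.lt_succ_self k)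
  law k := hlaw _ (by omega)
  indep k := by
    have hm : ∀ i, Measurable (Xs (i + 2)) := fun i => hXs _ (by omega)
    have h1 : iIndepFun (fun n : ℕ => Xs (n + 2)) μ :=
      hindep.precomp (g := fun n : ℕ => n + 1) (add_left_injective 1)
    have h2 : IndepFun (fun ω (i : Finset.range k) => Xs (i + 2) ω) (Xs (k + 2)) μ := by
      have := h1.indepFun_finset (Finset.range k) {k} (by simp) hm
      exact this.comp measurable_id
        (measurable_pi_apply (⟨k, Finset.mem_singleton_self k⟩ : ({k} : Finset ℕ)))
    have h3 : IndepFun Z₁ (fun ω => (fun i : Finset.range k => Xs (i + 2) ω, Xs (k + 2) ω)) μ := by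
      have hφ : Measurable fun (y : ℕ → H) => (fun i : Finset.range k => y i, y k) := by fun_prop
      exact hZ₁indep.comp measurable_id hφ
    exact IndepFun.prodMk_left_of_prodMk_right hZ₁ (measurable_pi_lambda _ fun i => hm i) (hm k)
      h3 h2
  bounded := ⟨hZ₁.aestronglyMeasurable, hbdd⟩
  succ k ω := rfl

lemma averaged_sub_eq (γ : ℕ → ℝ) (Xs : ℕ → Ω → H) (Z₁ : Ω → H) (m : H) {n : ℕ} (hn : 1 ≤ n)
    (ω : Ω) : averaged γ Xs Z₁ n ω - m =
      (n : ℝ)⁻¹ • ∑ k ∈ Finset.range n, (robbinsMonro γ Xs Z₁ (k + 1) ω - m) := by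
  have hn' : (n : ℝ) ≠ 0 := by positivity
  have h : ∑ k ∈ Finset.Icc 1 n, robbinsMonro γ Xs Z₁ k ω =
      ∑ k ∈ Finset.range n, robbinsMonro γ Xs Z₁ (k + 1) ω := by
    rw [Finset.range_eq_Ico, Finset.sum_Ico_add' (fun k => robbinsMonro γ Xs Z₁ k ω) 0 n 1]
    rfl
  rw [averaged, h, Finset.sum_sub_distrib, smul_sub, Finset.sum_const, Finset.card_range,
    ← Nat.cast_smul_eq_nsmul ℝ, smul_smul, inv_mul_cancel₀ hn', one_smul]

end Algorithm

end GeometricMedian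

/-! ### The three claims. -/

open GeometricMedian
theorem proposition4p1
    {Ω H : Type*} [MeasurableSpace Ω] (μ : Measure Ω) [IsProbabilityMeasure μ]
    [NormedAddCommGroup H] [InnerProductSpace ℝ H] [CompleteSpace H]
    [TopologicalSpace.SeparableSpace H] [MeasurableSpace H] [BorelSpace H]
    -- the random variable `X`, its two assumptions, and its median
    (X : Ω → H) (hX : Measurable X)
    (hA1 : NotOnLine μ X) (hA2 : NotAroundPoints μ X)
    (m : H) (hm : IsMedian μ X m)
    -- the sample `X_1, X_2, …`: independent with the law of `X`
    (Xs : ℕ → Ω → H) (hXs : ∀ n, 1 ≤ n → Measurable (Xs n))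
    (hlaw : ∀ n, 1 ≤ n → IdentDistrib (Xs n) X μ μ)
    (hindep : iIndepFun (fun n : ℕ => Xs (n + 1)) μ)
    -- the bounded initialization, independent of `X_2, X_3, …`
    (Z₁ : Ω → H) (hZ₁ : Measurable Z₁) (hbdd : ∃ M : ℝ, ∀ᵐ ω ∂μ, ‖Z₁ ω‖ ≤ M)
    (hZ₁indep : IndepFun Z₁ (fun ω (n : ℕ) => Xs (n + 2) ω) μ)
    -- the steps `γ_n = c_γ n^{-α}`
    (cγ α : ℝ) (hcγ : 0 < cγ) (hα : 1 / 2 < α) (hα' : α < 1) :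
    -- the lower bound in quadratic mean; only `n = 1` with `Z_1 = m` a.s. is exempt
    (∃ c : ℝ, 0 < c ∧ ∀ n : ℕ, 1 ≤ n → (n = 1 → ¬ ∀ᵐ ω ∂μ, Z₁ ω = m) →
      c / n ≤ ∫ ω, ‖averaged (step cγ α) Xs Z₁ n ω - m‖ ^ 2 ∂μ) ∧
    -- the lower bounds for the higher moments
    (∀ p : ℕ, 1 ≤ p → ∃ c : ℝ, 0 < c ∧ ∀ n : ℕ, 1 ≤ n → (n = 1 → ¬ ∀ᵐ ω ∂μ, Z₁ ω = m) →
      c / (n : ℝ) ^ p ≤ ∫ ω, ‖averaged (step cγ α) Xs Z₁ n ω - m‖ ^ (2 * p) ∂μ) ∧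
    -- `E‖Γ_m (Z̄_n - m)‖² = 1/n + o(1/n)`
    ((fun n : ℕ => (∫ ω, ‖hessian μ X m (averaged (step cγ α) Xs Z₁ n ω - m)‖ ^ 2 ∂μ)
        - 1 / (n : ℝ)) =o[atTop] fun n : ℕ => 1 / (n : ℝ)) := by
  obtain ⟨C, hA⟩ := hA2.exists_invMomentBound hX
  have hm0 := meanDir_eq_zero hX hA hm
  set z : ℕ → Ω → H := fun k => robbinsMonro (step cγ α) Xs Z₁ (k + 1) with hz
  have hR : GradientRecursion μ X (fun k => step cγ α (k + 1)) (past Xs Z₁)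
      (fun k => Xs (k + 2)) z :=
    gradientRecursion_robbinsMonro hXs hlaw hindep hZ₁ hbdd hZ₁indep _
  have hg : ∀ k : ℕ, step cγ α (k + 1) = cγ * ((k : ℝ) + 1) ^ (-α) := fun k => by
    rw [step]; push_cast; rfl
  have hlim := hR.tendsto_integral_norm_meanDeriv_sum_sq_div hX hA1 hA hm0 hcγ hα hα' hg
  have hS : ∀ n, AEBounded μ fun ω => ∑ k ∈ Finset.range n, (z k ω - m) := fun n =>
    AEBounded.sum _ fun k _ => hR.aebounded_dev k
  have havg : ∀ n, 1 ≤ n → ∀ ω, averaged (step cγ α) Xs Z₁ n ω - m =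
      (n : ℝ)⁻¹ • ∑ k ∈ Finset.range n, (z k ω - m) := fun n hn ω =>
    averaged_sub_eq _ Xs Z₁ m hn ω
  have hlower : ∃ c : ℝ, 0 < c ∧ ∀ n : ℕ, (1 ≤ n ∧ (n = 1 → ¬ ∀ᵐ ω ∂μ, Z₁ ω = m)) →
      c ≤ (∫ ω, ‖∑ k ∈ Finset.range n, (z k ω - m)‖ ^ 2 ∂μ) / n := by
    set l := ‖meanDeriv μ X m‖ with hl
    -- Eventually `E‖Γ S_n‖² / n > 1 / 2`, while `‖Γ S_n‖² ≤ l ^ 2 * ‖S_n‖²`; the `+ 1` keeps the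
    -- denominator positive without a separate case `l = 0`.
    refine exists_pos_le_of_eventually (c := 1 / 2 / (l ^ 2 + 1)) (by positivity) ?_ ?_
    · rintro n ⟨hn, hne⟩
      have hn' : (0 : ℝ) < n := by exact_mod_cast hn
      refine div_pos ?_ hn'
      obtain rfl | ⟨k, rfl⟩ : n = 1 ∨ ∃ k, n = k + 2 := by
        rcases Nat.lt_or_ge 1 n with h | h
        · exact Or.inr ⟨n - 2, by omega⟩
        · exact Or.inl (by omega)
      · refine lt_of_le_of_ne (integral_nonneg fun ω => by positivity) fun h0 => hne rfl ?_
        have := (integral_eq_zero_iff_of_nonneg (fun ω => by positivity)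
          ((hS 1).norm.pow 2).integrable).1 h0.symm
        filter_upwards [this] with ω hω
        simpa [hz, robbinsMonro, sub_eq_zero] using hω
      · exact hR.integral_norm_sum_sq_pos hX hA1 hA k (by rw [hg]; positivity)
    · filter_upwards [hlim.eventually (lt_mem_nhds (by norm_num : (1 / 2 : ℝ) < 1))] with n hn
      rw [div_le_iff₀ (by positivity)]
      refine hn.le.trans ?_
      rw [div_mul_eq_mul_div]
      refine div_le_div_of_nonneg_right ?_ (Nat.cast_nonneg n)
      rw [← integral_mul_const]
      refine integral_mono (((hS n).clm _).norm.pow 2).integrable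
        (((hS n).norm.pow 2).integrable.mul_const _) fun ω => ?_
      have h1 := pow_le_pow_left₀ (norm_nonneg _) ((meanDeriv μ X m).le_opNorm
        (∑ k ∈ Finset.range n, (z k ω - m))) 2
      refine h1.trans ?_
      rw [mul_pow, mul_comm]
      gcongr
      linarith
  have hsq : ∃ c : ℝ, 0 < c ∧ ∀ n : ℕ, 1 ≤ n → (n = 1 → ¬ ∀ᵐ ω ∂μ, Z₁ ω = m) →
      c / n ≤ ∫ ω, ‖averaged (step cγ α) Xs Z₁ n ω - m‖ ^ 2 ∂μ := by
    obtain ⟨c, hc, h⟩ := hlower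
    refine ⟨c, hc, fun n hn hne => ?_⟩
    have hn' : (0 : ℝ) < n := by exact_mod_cast hn
    have h1 := h n ⟨hn, hne⟩
    simp only [havg n hn, norm_smul, mul_pow, integral_const_mul, norm_inv, Real.norm_natCast]
    rw [le_div_iff₀ hn'] at h1
    rw [div_le_iff₀ hn']
    calc c = (n : ℝ)⁻¹ ^ 2 * (c * n) * n := by field_simp
      _ ≤ _ := by gcongr
  refine ⟨hsq, fun p _ => ?_, ?_⟩
  · obtain ⟨c, hc, h⟩ := hsq
    refine ⟨c ^ p, by positivity, fun n hn hne => ?_⟩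
    have hb : AEBounded μ fun ω => averaged (step cγ α) Xs Z₁ n ω - m := by
      rw [funext (havg n hn)]
      exact (hS n).const_smul _
    simp only [pow_mul]
    rw [← div_pow]
    -- Jensen's inequality for `t ↦ t ^ p` applied to the squared deviation.
    exact (pow_le_pow_left₀ (by positivity) (h n hn hne) p).trans
      (pow_integral_le (hb.norm.pow 2) (fun ω => by positivity) p)
  · rw [hessian_eq_meanDeriv hX hA]
    have hlim0 := hlim.sub_const 1
    rw [sub_self] at hlim0
    -- Multiplying the `o(1)` error of the normalized second moment by `1 / n` gives the expansion,
    -- since `S_n` is `n` times the averaged deviation.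
    have ho := ((Asymptotics.isLittleO_one_iff ℝ).2 hlim0).mul_isBigO
      (Asymptotics.isBigO_refl (fun n : ℕ => 1 / (n : ℝ)) atTop)
    simp only [one_mul] at ho
    refine ho.congr' ?_ EventuallyEq.rfl
    filter_upwards [eventually_ge_atTop 1] with n hn
    have hn' : (n : ℝ) ≠ 0 := by positivity
    simp only [havg n hn, map_smul, norm_smul, mul_pow, integral_const_mul, norm_inv,
      Real.norm_natCast]
    field_simp
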